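/- Let $K_n$ and $C_n$ denote the complete graph and the cycle on $n$ vertices, let $\cup$ denote disjoint union of graphs, let $qG$ denote the disjoint union of $q$ copies of $G$, and let the join $G\vee H$ be obtained from $G\cup H$ by adding all edges between vertices of $G$ and vertices of $H$. For a finite simple graph $G$ with adjacency matrix $A(G)$ and diagonal matrix of vertex degrees $D(G)$, the signless Laplacian spectrum ($Q$-spectrum) of $G$ is the multiset of eigenvalues of $Q(G)=A(G)+D(G)$, counted with multiplicity. Theorem. Let $q\ge 0$ and $s\ge 3$ be integers such that the graph $G=K_1\vee (C_s\cup qK_2)$ has at least $16$ vertices, i.e. $1+s+2q\ge 16$. Then $G$ is determined by its signless Laplacian spectrum: every finite simple graph with the same $Q$-spectrum as $G$ is isomorphic to $G$. -/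

import Mathlib

universe u v

namespace QSpectral

/-- The join `G ∨ H`: the disjoint union of `G` and `H` together with all edges between the
vertices of `G` and the vertices of `H`. -/
def join {V W : Type*} (G : SimpleGraph V) (H : SimpleGraph W) : SimpleGraph (V ⊕ W) :=
  SimpleGraph.sum G H ⊔ completeBipartiteGraph V W

/-- The disjoint union `qG` of `q` copies of `G`. -/
def copies {V : Type*} (q : ℕ) (G : SimpleGraph V) : SimpleGraph (Fin q × V) where
  Adj x y := x.1 = y.1 ∧ G.Adj x.2 y.2
  symm := ⟨fun _ _ h => ⟨h.1.symm, h.2.symm⟩⟩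
  loopless := ⟨fun _ h => G.irrefl h.2⟩

/-- The signless Laplacian matrix `Q(G) = A(G) + D(G)`, with real entries. -/
def signlessLaplacian {V : Type*} [Fintype V] [DecidableEq V] (G : SimpleGraph V)
    [DecidableRel G.Adj] : Matrix V V ℝ :=
  G.adjMatrix ℝ + G.degMatrix ℝ

open Classical in
/-- The signless Laplacian spectrum: the multiset of eigenvalues of `Q(G)`, counted with
multiplicity, that is, the roots of its characteristic polynomial (`Q(G)` is real symmetric, so
all its eigenvalues are real). -/
noncomputable def qSpectrum {V : Type*} [Fintype V] (G : SimpleGraph V) : Multiset ℝ :=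
  (signlessLaplacian G).charpoly.roots

/-- `G` is determined by its signless Laplacian spectrum: every finite simple graph with the same
signless Laplacian spectrum as `G` is isomorphic to `G`. -/
def IsDQS {V : Type u} [Fintype V] (G : SimpleGraph V) : Prop :=
  ∀ (W : Type v) [Fintype W] (H : SimpleGraph W), qSpectrum H = qSpectrum G → Nonempty (H ≃g G)

/-- The graph `K_1 ∨ (C_s ∪ qK_2)`. -/
def coneGraph (s q : ℕ) : SimpleGraph (Fin 1 ⊕ (Fin s ⊕ Fin q × Fin 2)) :=
  join (SimpleGraph.completeGraph (Fin 1))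
    (SimpleGraph.sum (SimpleGraph.cycleGraph s)
      (copies q (SimpleGraph.completeGraph (Fin 2))))

end QSpectral

/-!
Let `Q(G)` be the signless Laplacian matrix of a graph `G`. The matrices `Q` of two graphs `G` and
`H` with the same spectrum share the trace and the trace of the square, hence the sum of the
degrees and the sum of their squares, a lower bound for the quadratic form, the number of
eigenvalues above a threshold, and each single eigenvalue. For the cone `G = K_1 ∨ (C_s ∪ q K_2)`
on `n` vertices, all eigenvalues are at least `1` (`cone_lower_bound`), only one of them is at
least `5` (`cone_hyperplane_bound`), and the largest one, `c`, solves the secular equation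
`c - (n - 1) = s / (c - 5) + 2 q / (c - 3)` (`cone_exists_large_eigenvalue`). These data suffice.

*Degrees* (`exists_dominating_vertex`). The bound `1` forces minimum degree at least `2`. Two
vertices of degree at least `6` would make the form at least `5` on a plane, so all degrees
except the largest one lie in `[2, 5]`. The two degree sums then leave only maximum degree `n - 1`
or `n - 2`; a vertex of degree `5` again gives a plane on which the form is at least `5` (this
uses `n ≥ 16`), and without such vertices `n - 2` is impossible. So `H` has a dominating
vertex `u`, and the other vertices have degree `2` or `3`.

*Components of `H - u`* (`degree_eq_of_adj_deleteVertex`). Let `B` be the signless Laplacian of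
`H - u` and `e` the all-ones vector. That `c` is an eigenvalue of `H` means that
`⟨e, (c - 1 - B)⁻¹ e⟩ = c - (n - 1)`. The spectral measure of `e` for `B` has the same moments of
order `0, 1, 2` as the measure `s δ₄ + 2 q δ₂` belonging to `G`, and it lives on `[0, 4]`. By the
error formula of Hermite interpolation at `4, 2, 2`, the measure on `{2, 4}` is the unique
maximizer of the resolvent (`annihilates_of_resolvent_eq`). Equality therefore forces
`(B - 2)(B - 4) e = 0`, and this says that every component of `H - u` is regular.

*Conclusion*. Two `2`-regular components of `H - u` would give an eigenvector of `H` for `5`, and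
with `u` a plane on which the form is at least `5`. So `H - u` consists of one cycle and a perfect
matching, with the right numbers of vertices (`nonempty_iso_coneGraph`).
-/

/-! ### Linear algebra -/

namespace QSpectral

open Matrix Finset

/-- Spectral theorem for real symmetric matrices, with the eigenvalues listed as the roots of the
characteristic polynomial. -/
lemma exists_orthogonal_diagonalization {V : Type*} [Fintype V] [DecidableEq V]
    {A : Matrix V V ℝ} (hA : A.IsSymm) :
    ∃ (d : V → ℝ) (U : Matrix V V ℝ), Uᵀ * U = 1 ∧ U * Uᵀ = 1 ∧ A = U * diagonal d * Uᵀ ∧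
      A.charpoly.roots = univ.val.map d := by
  have hA' : A.IsHermitian := by
    rw [IsHermitian, conjTranspose_eq_transpose_of_trivial]; exact hA
  refine ⟨hA'.eigenvalues, hA'.eigenvectorUnitary, ?_, ?_, ?_, ?_⟩
  · have := Unitary.coe_star_mul_self hA'.eigenvectorUnitary
    rwa [star_eq_conjTranspose, conjTranspose_eq_transpose_of_trivial] at this
  · have := Unitary.coe_mul_star_self hA'.eigenvectorUnitary
    rwa [Unitary.coe_star, star_eq_conjTranspose, conjTranspose_eq_transpose_of_trivial] at this
  · have := hA'.spectral_theorem
    rw [Unitary.conjStarAlgAut_apply, star_eq_conjTranspose,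
      conjTranspose_eq_transpose_of_trivial] at this
    exact this
  · exact hA'.roots_charpoly_eq_eigenvalues

section Diagonalized

variable {V : Type*} [Fintype V] [DecidableEq V] {A U : Matrix V V ℝ} {d : V → ℝ}

lemma dotProduct_self_eq_sum_coords (hU : U * Uᵀ = 1) (x : V → ℝ) :
    x ⬝ᵥ x = ∑ i, (Uᵀ *ᵥ x) i ^ 2 := by
  have : (Uᵀ *ᵥ x) ⬝ᵥ (Uᵀ *ᵥ x) = x ⬝ᵥ x := by
    rw [dotProduct_mulVec, vecMul_transpose, mulVec_mulVec, hU, one_mulVec]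
  rw [← this]
  simp [dotProduct, sq]

lemma dotProduct_mulVec_eq_sum_coords (hA : A = U * diagonal d * Uᵀ) (x : V → ℝ) :
    x ⬝ᵥ A *ᵥ x = ∑ i, d i * (Uᵀ *ᵥ x) i ^ 2 := by
  rw [hA, ← mulVec_mulVec, ← mulVec_mulVec, dotProduct_mulVec, ← mulVec_transpose]
  simp only [dotProduct, mulVec_diagonal]
  exact sum_congr rfl fun i _ => by ring

lemma transpose_mulVec_col (hU : Uᵀ * U = 1) (i : V) :
    Uᵀ *ᵥ (U *ᵥ Pi.single i 1) = Pi.single i 1 := by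
  rw [mulVec_mulVec, hU, one_mulVec]

lemma mulVec_col (hU : Uᵀ * U = 1) (hA : A = U * diagonal d * Uᵀ) (i : V) :
    A *ᵥ (U *ᵥ Pi.single i 1) = d i • (U *ᵥ Pi.single i 1) := by
  rw [hA, ← mulVec_mulVec, ← mulVec_mulVec, transpose_mulVec_col hU, diagonal_mulVec_single,
    ← mulVec_smul]
  congr 1
  ext j
  by_cases h : j = i
  · subst h; simp
  · simp [h]

lemma eq_zero_of_transpose_mulVec (hU : U * Uᵀ = 1) {x : V → ℝ} (hx : Uᵀ *ᵥ x = 0) : x = 0 := by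
  rw [← one_mulVec x, ← hU, ← mulVec_mulVec, hx, mulVec_zero]

lemma trace_sq_eq_sum_coords (hU : Uᵀ * U = 1) (hA : A = U * diagonal d * Uᵀ) :
    (A * A).trace = ∑ i, d i ^ 2 := by
  have : A * A = U * diagonal (fun i => d i ^ 2) * Uᵀ := by
    calc A * A = U * diagonal d * (Uᵀ * U) * diagonal d * Uᵀ := by
          rw [hA]; simp only [Matrix.mul_assoc]
      _ = _ := by
          rw [hU, Matrix.mul_one, Matrix.mul_assoc U, diagonal_mul_diagonal]
          simp only [sq]
  rw [this, trace_mul_comm, ← mul_assoc, hU, one_mul, trace_diagonal]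

end Diagonalized

section Cospectral

variable {V : Type*} {W : Type*} [Fintype V] [DecidableEq V] [Fintype W] [DecidableEq W]
  {A : Matrix V V ℝ} {B : Matrix W W ℝ}

lemma card_eq_of_roots_eq (hA : A.IsSymm) (hB : B.IsSymm)
    (h : A.charpoly.roots = B.charpoly.roots) : Fintype.card V = Fintype.card W := by
  obtain ⟨d, U, -, -, -, hd⟩ := exists_orthogonal_diagonalization hA
  obtain ⟨e, U', -, -, -, he⟩ := exists_orthogonal_diagonalization hB
  rw [hd, he] at h
  simpa using congrArg Multiset.card h

lemma trace_eq_of_roots_eq (hA : A.IsSymm) (hB : B.IsSymm)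
    (h : A.charpoly.roots = B.charpoly.roots) : A.trace = B.trace := by
  obtain ⟨d, U, hU, -, hAd, hd⟩ := exists_orthogonal_diagonalization hA
  obtain ⟨e, U', hU', -, hBe, he⟩ := exists_orthogonal_diagonalization hB
  rw [hd, he] at h
  have h1 : A.trace = ∑ i, d i := by
    rw [hAd, trace_mul_comm, ← mul_assoc, hU, one_mul, trace_diagonal]
  have h2 : B.trace = ∑ i, e i := by
    rw [hBe, trace_mul_comm, ← mul_assoc, hU', one_mul, trace_diagonal]
  rw [h1, h2]
  exact congrArg Multiset.sum h

lemma trace_sq_eq_of_roots_eq (hA : A.IsSymm) (hB : B.IsSymm)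
    (h : A.charpoly.roots = B.charpoly.roots) : (A * A).trace = (B * B).trace := by
  obtain ⟨d, U, hU, -, hAd, hd⟩ := exists_orthogonal_diagonalization hA
  obtain ⟨e, U', hU', -, hBe, he⟩ := exists_orthogonal_diagonalization hB
  rw [hd, he] at h
  rw [trace_sq_eq_sum_coords hU hAd, trace_sq_eq_sum_coords hU' hBe]
  have := congrArg (fun m : Multiset ℝ => (m.map (· ^ 2)).sum) h
  simp only [Multiset.map_map] at this
  exact this

lemma exists_mulVec_eq_smul_of_roots_eq (hA : A.IsSymm) (hB : B.IsSymm)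
    (h : A.charpoly.roots = B.charpoly.roots) {c : ℝ} (hc : ∃ x ≠ 0, A *ᵥ x = c • x) :
    ∃ x ≠ 0, B *ᵥ x = c • x := by
  obtain ⟨d, U, hU, hU1, hAd, hd⟩ := exists_orthogonal_diagonalization hA
  obtain ⟨e, U', hU', hU1', hBe, he⟩ := exists_orthogonal_diagonalization hB
  rw [hd, he] at h
  obtain ⟨x, hx, hAx⟩ := hc
  obtain ⟨i, hi⟩ : ∃ i, (Uᵀ *ᵥ x) i ≠ 0 := by
    by_contra! hcon
    exact hx (eq_zero_of_transpose_mulVec hU1 (funext hcon))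
  have h1 : Uᵀ *ᵥ (A *ᵥ x) = diagonal d *ᵥ (Uᵀ *ᵥ x) := by
    rw [hAd, ← mulVec_mulVec, ← mulVec_mulVec, mulVec_mulVec _ Uᵀ U, hU, one_mulVec]
  rw [hAx, mulVec_smul] at h1
  have h2 := congrFun h1 i
  rw [mulVec_diagonal, Pi.smul_apply, smul_eq_mul] at h2
  have hdi : d i = c := (mul_right_cancel₀ hi h2).symm
  have : d i ∈ univ.val.map e := by
    rw [← h]; exact Multiset.mem_map_of_mem _ (mem_univ i)
  obtain ⟨j, -, hj⟩ := Multiset.mem_map.1 this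
  refine ⟨U' *ᵥ Pi.single j 1, ?_, ?_⟩
  · intro h0
    have := transpose_mulVec_col hU' j
    rw [h0, mulVec_zero] at this
    simpa using congrFun this j
  · rw [mulVec_col hU' hBe, hj, hdi]

lemma lower_bound_of_roots_eq (hA : A.IsSymm) (hB : B.IsSymm)
    (h : A.charpoly.roots = B.charpoly.roots) {c : ℝ} (hc : ∀ x, c * (x ⬝ᵥ x) ≤ x ⬝ᵥ A *ᵥ x)
    (y : W → ℝ) : c * (y ⬝ᵥ y) ≤ y ⬝ᵥ B *ᵥ y := by
  obtain ⟨d, U, hU, hU1, hAd, hd⟩ := exists_orthogonal_diagonalization hA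
  obtain ⟨e, U', hU', hU1', hBe, he⟩ := exists_orthogonal_diagonalization hB
  rw [hd, he] at h
  have hd' : ∀ i, c ≤ d i := by
    intro i
    have := hc (U *ᵥ Pi.single i 1)
    rw [dotProduct_self_eq_sum_coords hU1, dotProduct_mulVec_eq_sum_coords hAd,
      transpose_mulVec_col hU] at this
    simpa [Pi.single_apply, ite_pow] using this
  have he' : ∀ j, c ≤ e j := by
    intro j
    have : e j ∈ univ.val.map d := by
      rw [h]; exact Multiset.mem_map_of_mem _ (mem_univ j)
    obtain ⟨i, -, hi⟩ := Multiset.mem_map.1 this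
    rw [← hi]; exact hd' i
  rw [dotProduct_self_eq_sum_coords hU1', dotProduct_mulVec_eq_sum_coords hBe, mul_sum]
  exact sum_le_sum fun i _ => mul_le_mul_of_nonneg_right (he' i) (sq_nonneg _)

/-- If the quadratic form of `A` is below `c` on a hyperplane, then `A` has at most one eigenvalue
`≥ c`, counted with multiplicity, hence the same holds for `B`, whose form is then below `c` on
the orthogonal complement of the corresponding eigenvector. -/
lemma hyperplane_bound_of_roots_eq (hA : A.IsSymm) (hB : B.IsSymm)
    (h : A.charpoly.roots = B.charpoly.roots) {c : ℝ}
    (hc : ∃ l : V → ℝ, ∀ x ≠ 0, l ⬝ᵥ x = 0 → x ⬝ᵥ A *ᵥ x < c * (x ⬝ᵥ x)) :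
    ∃ l : W → ℝ, ∀ x ≠ 0, l ⬝ᵥ x = 0 → x ⬝ᵥ B *ᵥ x < c * (x ⬝ᵥ x) := by
  obtain ⟨d, U, hU, hU1, hAd, hd⟩ := exists_orthogonal_diagonalization hA
  obtain ⟨e, U', hU', hU1', hBe, he⟩ := exists_orthogonal_diagonalization hB
  rw [hd, he] at h
  obtain ⟨l, hl⟩ := hc
  -- two eigenvectors with eigenvalues `≥ c` would span a plane meeting the hyperplane `l = 0`
  have hd1 : ∀ i j, c ≤ d i → c ≤ d j → i = j := by
    intro i j hi hj
    by_contra hij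
    obtain ⟨a, b, hab, hlab⟩ : ∃ a b : ℝ, (a ≠ 0 ∨ b ≠ 0) ∧
        l ⬝ᵥ (U *ᵥ (a • Pi.single i 1 + b • Pi.single j 1)) = 0 := by
      simp only [mulVec_add, mulVec_smul, dotProduct_add, dotProduct_smul, smul_eq_mul]
      set α := l ⬝ᵥ U *ᵥ Pi.single i 1
      set β := l ⬝ᵥ U *ᵥ Pi.single j 1
      by_cases hα : α = 0
      · exact ⟨1, 0, by simp, by simp [hα]⟩
      · exact ⟨β, -α, by simp [hα], by ring⟩
    have hcoord : Uᵀ *ᵥ (U *ᵥ (a • Pi.single i 1 + b • Pi.single j 1)) =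
        a • Pi.single i 1 + b • Pi.single j 1 := by
      rw [mulVec_mulVec, hU, one_mulVec]
    have hne : U *ᵥ (a • Pi.single i 1 + b • Pi.single j 1) ≠ 0 := by
      intro h0
      rw [h0, mulVec_zero] at hcoord
      have h1 := congrFun hcoord i
      have h2 := congrFun hcoord j
      simp [hij, Ne.symm hij] at h1 h2
      grind
    have := hl _ hne hlab
    rw [dotProduct_self_eq_sum_coords hU1, dotProduct_mulVec_eq_sum_coords hAd, hcoord,
      mul_sum] at this
    refine absurd this (not_lt.2 (sum_le_sum fun k _ => ?_))
    by_cases hki : k = i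
    · subst hki; exact mul_le_mul_of_nonneg_right hi (sq_nonneg _)
    · by_cases hkj : k = j
      · subst hkj; exact mul_le_mul_of_nonneg_right hj (sq_nonneg _)
      · simp [hki, hkj]
  have hcount : (univ.filter fun j => c ≤ e j).card ≤ 1 := by
    have h1 := congrArg (Multiset.countP (c ≤ ·)) h
    rw [Multiset.countP_map, Multiset.countP_map] at h1
    have h2 : (univ.filter fun i => c ≤ d i).card ≤ 1 :=
      card_le_one.2 fun i hi j hj => hd1 i j (mem_filter.1 hi).2 (mem_filter.1 hj).2
    exact h1.symm.le.trans h2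
  have he1 : ∀ i j, c ≤ e i → c ≤ e j → i = j := fun i j hi hj =>
    card_le_one.1 hcount i (by simpa using hi) j (by simpa using hj)
  obtain ⟨l', hl'⟩ : ∃ l' : W → ℝ, ∀ x, l' ⬝ᵥ x = 0 → ∀ i, c ≤ e i → (U'ᵀ *ᵥ x) i = 0 := by
    by_cases hex : ∃ i, c ≤ e i
    · obtain ⟨i, hi⟩ := hex
      refine ⟨U'ᵀ i, fun x hx j hj => ?_⟩
      rw [he1 j i hj hi]; exact hx
    · exact ⟨0, fun x _ i hi => (hex ⟨i, hi⟩).elim⟩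
  refine ⟨l', fun x hx hlx => ?_⟩
  rw [dotProduct_self_eq_sum_coords hU1', dotProduct_mulVec_eq_sum_coords hBe, mul_sum]
  obtain ⟨i, hi⟩ : ∃ i, (U'ᵀ *ᵥ x) i ≠ 0 := by
    by_contra! hcon
    exact hx (eq_zero_of_transpose_mulVec hU1' (funext hcon))
  have hei : ∀ j, (U'ᵀ *ᵥ x) j ≠ 0 → e j < c := fun j hj => by
    by_contra! hcj
    exact hj (hl' x hlx j hcj)
  refine sum_lt_sum (fun j _ => ?_) ⟨i, mem_univ i, ?_⟩
  · by_cases hj : (U'ᵀ *ᵥ x) j = 0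
    · simp [hj]
    · exact mul_le_mul_of_nonneg_right (hei j hj).le (sq_nonneg _)
  · exact mul_lt_mul_of_pos_right (hei i hi) (by positivity)

end Cospectral

/-- If the form of a symmetric matrix is below `c` on a hyperplane, then no two linearly
independent vectors span a plane on which the form is at least `c`. The last hypotheses say
that the Gram matrix of the form `x ↦ ⟨x, Ax⟩ - c⟨x, x⟩` on the two vectors is positive
semidefinite. -/
lemma not_two_large_directions {V : Type*} [Fintype V] {A : Matrix V V ℝ} (hA : A.IsSymm) {c : ℝ}
    (hc : ∃ l : V → ℝ, ∀ x ≠ 0, l ⬝ᵥ x = 0 → x ⬝ᵥ A *ᵥ x < c * (x ⬝ᵥ x))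
    {x y : V → ℝ} (hxy : ∀ a b : ℝ, a • x + b • y = 0 → a = 0 ∧ b = 0) {α β γ : ℝ}
    (hα : α ≤ x ⬝ᵥ A *ᵥ x - c * (x ⬝ᵥ x)) (hβ : x ⬝ᵥ A *ᵥ y - c * (x ⬝ᵥ y) = β)
    (hγ : γ ≤ y ⬝ᵥ A *ᵥ y - c * (y ⬝ᵥ y)) (hα0 : 0 < α) (hdet : β ^ 2 ≤ α * γ) : False := by
  obtain ⟨l, hl⟩ := hc
  obtain ⟨a, b, hab, hlab⟩ : ∃ a b : ℝ, ¬ (a = 0 ∧ b = 0) ∧ l ⬝ᵥ (a • x + b • y) = 0 := by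
    simp only [dotProduct_add, dotProduct_smul, smul_eq_mul]
    by_cases h : l ⬝ᵥ x = 0
    · exact ⟨1, 0, by simp, by simp [h]⟩
    · exact ⟨l ⬝ᵥ y, -(l ⬝ᵥ x), by simp [h], by ring⟩
  have h1 := hl (a • x + b • y) (fun h0 => hab (hxy a b h0)) hlab
  have hsymm : y ⬝ᵥ A *ᵥ x = x ⬝ᵥ A *ᵥ y := by
    rw [dotProduct_mulVec, ← mulVec_transpose, hA.eq, dotProduct_comm]
  simp only [mulVec_add, mulVec_smul, dotProduct_add, add_dotProduct, dotProduct_smul,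
    smul_dotProduct, smul_eq_mul, hsymm, dotProduct_comm y x] at h1
  have h2 : 0 ≤ a ^ 2 * α + 2 * a * b * β + b ^ 2 * γ := by
    have : 0 ≤ α * (a ^ 2 * α + 2 * a * b * β + b ^ 2 * γ) := by
      nlinarith [sq_nonneg (a * α + b * β), mul_le_mul_of_nonneg_left hdet (sq_nonneg b)]
    exact nonneg_of_mul_nonneg_right this hα0
  rw [← hβ] at h2
  nlinarith [mul_le_mul_of_nonneg_left hα (sq_nonneg a),
    mul_le_mul_of_nonneg_left hγ (sq_nonneg b)]

/-- Let `B ≤ 4` be symmetric and suppose that the vector `e` has the same zeroth, first and second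
moments with respect to `B` as the measure `a δ₄ + b δ₂`. Among such vectors, the resolvent
`⟨e, (μ - B)⁻¹ e⟩` at `μ > 4` is largest precisely when the spectral measure of `e` is supported
on `{2, 4}`: interpolating `t ↦ 1 / (μ - t)` by a quadratic polynomial simply at `4` and doubly
at `2` leaves the error `(t - 4)(t - 2)² / ((μ - 4)(μ - 2)²(μ - t)) ≤ 0`. -/
lemma annihilates_of_resolvent_eq {V : Type*} [Fintype V] {B : Matrix V V ℝ} (hB : B.IsSymm)
    (hB4 : ∀ x, x ⬝ᵥ B *ᵥ x ≤ 4 * (x ⬝ᵥ x)) {μ a b : ℝ} (hμ : 4 < μ) {e y : V → ℝ}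
    (hy : e = μ • y - B *ᵥ y) (h0 : e ⬝ᵥ e = a + b) (h1 : e ⬝ᵥ B *ᵥ e = 4 * a + 2 * b)
    (h2 : (B *ᵥ e) ⬝ᵥ (B *ᵥ e) = 16 * a + 4 * b)
    (hres : e ⬝ᵥ y = a / (μ - 4) + b / (μ - 2)) :
    B *ᵥ (B *ᵥ e) - (6 : ℝ) • (B *ᵥ e) + (8 : ℝ) • e = 0 := by
  have hsymm : ∀ x z : V → ℝ, x ⬝ᵥ B *ᵥ z = (B *ᵥ x) ⬝ᵥ z := fun x z => by
    rw [dotProduct_mulVec, ← mulVec_transpose, hB.eq]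
  set y1 := B *ᵥ y with hy1
  set y2 := B *ᵥ y1 with hy2
  have hBe : B *ᵥ e = μ • y1 - y2 := by rw [hy, mulVec_sub, mulVec_smul]
  have e02 : y ⬝ᵥ y2 = y1 ⬝ᵥ y1 := by rw [hy2, hsymm]
  have e20 : y2 ⬝ᵥ y = y1 ⬝ᵥ y1 := by rw [dotProduct_comm, e02]
  -- `w = (B - 2) y` and `p = (4 - B) w`
  set w := y1 - (2 : ℝ) • y with hw
  have hBw : B *ᵥ w = y2 - (2 : ℝ) • y1 := by rw [hw, mulVec_sub, mulVec_smul]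
  set p := (4 : ℝ) • w - B *ᵥ w with hp
  have hwp : 0 ≤ w ⬝ᵥ p := by
    rw [hp, dotProduct_sub, dotProduct_smul, smul_eq_mul]
    linarith [hB4 w]
  rw [hBe] at h1 h2
  have hres' : (μ - 4) * (μ - 2) * (e ⬝ᵥ y) = a * (μ - 2) + b * (μ - 4) := by
    rw [hres]
    have : μ - 4 ≠ 0 := by linarith
    have : μ - 2 ≠ 0 := by linarith
    field_simp
  rw [hy] at h0 h1 hres'
  simp only [dotProduct_sub, sub_dotProduct, dotProduct_smul, smul_dotProduct, smul_eq_mul,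
    dotProduct_comm y1 y, dotProduct_comm y2 y1, e02] at h0 h1 h2 hres'
  have hzero : (μ - 4) * (w ⬝ᵥ p) + p ⬝ᵥ p = 0 := by
    rw [hp, hBw, hw]
    simp only [dotProduct_sub, sub_dotProduct, dotProduct_smul, smul_dotProduct, smul_eq_mul,
      dotProduct_comm y1 y, dotProduct_comm y2 y1, e02, e20]
    linear_combination -(μ - 2) * hres' + (μ ^ 2 - 8 * μ + 20) * h0 + (μ - 8) * h1 + h2
  have hpp : p ⬝ᵥ p = 0 := by
    have h3 : 0 ≤ p ⬝ᵥ p := by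
      simp only [dotProduct]; exact sum_nonneg fun i _ => mul_self_nonneg _
    nlinarith [mul_nonneg (by linarith : 0 ≤ μ - 4) hwp]
  have hp0 : p = 0 := dotProduct_self_eq_zero.1 hpp
  have hy2' : y2 = (6 : ℝ) • y1 - (8 : ℝ) • y := by
    rw [hp, hBw, hw] at hp0
    ext i
    have := congrFun hp0 i
    simp only [Pi.sub_apply, Pi.smul_apply, smul_eq_mul, Pi.zero_apply] at this ⊢
    linarith
  have hy3 : B *ᵥ y2 = (6 : ℝ) • y2 - (8 : ℝ) • y1 := by
    conv_lhs => rw [hy2']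
    rw [mulVec_sub, mulVec_smul, mulVec_smul]
  rw [hBe, mulVec_sub, mulVec_smul, ← hy2, hy3, hy]
  ext i
  have := congrFun hy2' i
  simp only [Pi.sub_apply, Pi.add_apply, Pi.smul_apply, smul_eq_mul, Pi.zero_apply] at this ⊢
  linear_combination μ * this

end QSpectral

/-! ### The signless Laplacian form -/

namespace QSpectral

open Matrix Finset

section Form

variable {V : Type*} [Fintype V] [DecidableEq V] (G : SimpleGraph V) [DecidableRel G.Adj]

lemma signlessLaplacian_isSymm : (signlessLaplacian G).IsSymm :=
  (G.isSymm_adjMatrix (α := ℝ)).add (isSymm_diagonal _)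

lemma signlessLaplacian_mulVec (x : V → ℝ) (v : V) :
    (signlessLaplacian G *ᵥ x) v = ∑ w, if G.Adj v w then x v + x w else 0 := by
  rw [signlessLaplacian, add_mulVec, Pi.add_apply, SimpleGraph.adjMatrix_mulVec_apply,
    SimpleGraph.degMatrix, mulVec_diagonal, ← sum_filter, sum_add_distrib, sum_const,
    ← SimpleGraph.neighborFinset_eq_filter, SimpleGraph.card_neighborFinset_eq_degree,
    nsmul_eq_mul, add_comm]

lemma signlessLaplacian_mulVec_one (v : V) :
    (signlessLaplacian G *ᵥ 1) v = 2 * (G.degree v : ℝ) := by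
  rw [signlessLaplacian_mulVec, ← sum_filter, ← SimpleGraph.neighborFinset_eq_filter]
  simp [two_mul]

lemma two_mul_signlessLaplacian_form (x : V → ℝ) :
    2 * (x ⬝ᵥ signlessLaplacian G *ᵥ x) =
      ∑ v, ∑ w, if G.Adj v w then (x v + x w) ^ 2 else 0 := by
  have h1 : x ⬝ᵥ signlessLaplacian G *ᵥ x =
      ∑ v, ∑ w, if G.Adj v w then x v * (x v + x w) else 0 := by
    simp only [dotProduct, signlessLaplacian_mulVec, mul_sum, mul_ite, mul_zero]
  have h2 : x ⬝ᵥ signlessLaplacian G *ᵥ x =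
      ∑ v, ∑ w, if G.Adj v w then x w * (x v + x w) else 0 := by
    rw [h1, sum_comm]
    simp only [G.adj_comm, add_comm]
  rw [two_mul]
  nth_rewrite 1 [h1]
  rw [h2, ← sum_add_distrib]
  refine sum_congr rfl fun v _ => ?_
  rw [← sum_add_distrib]
  refine sum_congr rfl fun w _ => ?_
  split_ifs <;> ring

lemma signlessLaplacian_trace : (signlessLaplacian G).trace = ∑ v, (G.degree v : ℝ) := by
  simp [signlessLaplacian, SimpleGraph.degMatrix, trace_diagonal]

lemma signlessLaplacian_trace_sq : (signlessLaplacian G * signlessLaplacian G).trace =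
    ∑ v, ((G.degree v : ℝ) ^ 2 + G.degree v) := by
  simp only [trace, diag_apply, mul_apply]
  refine sum_congr rfl fun v _ => ?_
  have : ∀ w, signlessLaplacian G v w * signlessLaplacian G w v =
      (if v = w then (G.degree v : ℝ) ^ 2 else 0) + if G.Adj v w then 1 else 0 := by
    intro w
    by_cases hvw : v = w
    · subst hvw; simp [signlessLaplacian, SimpleGraph.degMatrix, sq]
    · simp [signlessLaplacian, SimpleGraph.degMatrix, diagonal, hvw, Ne.symm hvw, G.adj_comm w v]
  simp_rw [this]
  rw [sum_add_distrib, sum_ite_eq, ← sum_filter, ← SimpleGraph.neighborFinset_eq_filter]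
  simp

/-- `Q(G) ≤ 2Δ(G)`. -/
lemma signlessLaplacian_form_le {k : ℕ} (hk : ∀ v, G.degree v ≤ k) (x : V → ℝ) :
    x ⬝ᵥ signlessLaplacian G *ᵥ x ≤ 2 * k * (x ⬝ᵥ x) := by
  have h0 : ∀ v, (∑ w, if G.Adj v w then x v ^ 2 else 0) ≤ k * x v ^ 2 := by
    intro v
    rw [← sum_filter, ← SimpleGraph.neighborFinset_eq_filter, sum_const, nsmul_eq_mul,
      SimpleGraph.card_neighborFinset_eq_degree]
    exact mul_le_mul_of_nonneg_right (by exact_mod_cast hk v) (sq_nonneg _)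
  have h1 : ∑ v, ∑ w, (if G.Adj v w then x v ^ 2 else 0) ≤ k * (x ⬝ᵥ x) := by
    simp only [dotProduct, mul_sum, ← sq]
    exact sum_le_sum fun v _ => h0 v
  have h2 : ∑ v, ∑ w, (if G.Adj v w then x w ^ 2 else 0) ≤ k * (x ⬝ᵥ x) := by
    rw [sum_comm]
    simp only [G.adj_comm]
    simpa only [G.adj_comm] using h1
  have h3 : ∑ v, ∑ w, (if G.Adj v w then (x v + x w) ^ 2 else 0) ≤
      2 * (∑ v, ∑ w, (if G.Adj v w then x v ^ 2 else 0)) +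
        2 * ∑ v, ∑ w, (if G.Adj v w then x w ^ 2 else 0) := by
    simp only [mul_sum, ← sum_add_distrib]
    refine sum_le_sum fun v _ => sum_le_sum fun w _ => ?_
    split_ifs
    · nlinarith [sq_nonneg (x v - x w)]
    · simp
  linarith [two_mul_signlessLaplacian_form G x]

end Form

end QSpectral

/-! ### The spectrum of the cone -/

namespace QSpectral

open Matrix Finset

lemma cone_dotProduct_self {k q : ℕ} (x : Fin 1 ⊕ (Fin (k + 3) ⊕ Fin q × Fin 2) → ℝ) :
    x ⬝ᵥ x = x (.inl 0) ^ 2 + ∑ i, x (.inr (.inl i)) ^ 2 +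
      ∑ a, (x (.inr (.inr (a, 0))) ^ 2 + x (.inr (.inr (a, 1))) ^ 2) := by
  simp only [dotProduct, Fintype.sum_sum_type, Fintype.sum_prod_type, Fin.sum_univ_two,
    univ_unique, Fin.default_eq_zero, sum_singleton, sq, add_assoc]

lemma sum_succ_cycle {k : ℕ} (f : Fin (k + 3) → ℝ) : ∑ i, f (i + 1) = ∑ i, f i :=
  Equiv.sum_comp (Equiv.addRight (1 : Fin (k + 3))) f

section Cone

variable {k q : ℕ} [DecidableEq (Fin 1 ⊕ (Fin (k + 3) ⊕ Fin q × Fin 2))]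
  [DecidableRel (coneGraph (k + 3) q).Adj]

lemma cone_mulVec_apex (x : Fin 1 ⊕ (Fin (k + 3) ⊕ Fin q × Fin 2) → ℝ) :
    (signlessLaplacian (coneGraph (k + 3) q) *ᵥ x) (.inl 0) =
      ∑ i, (x (.inl 0) + x (.inr (.inl i))) +
        ∑ a, ((x (.inl 0) + x (.inr (.inr (a, 0)))) + (x (.inl 0) + x (.inr (.inr (a, 1))))) := by
  rw [signlessLaplacian_mulVec]
  simp [coneGraph, join, Fintype.sum_prod_type]

lemma cone_mulVec_cycle (x : Fin 1 ⊕ (Fin (k + 3) ⊕ Fin q × Fin 2) → ℝ) (i : Fin (k + 3)) :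
    (signlessLaplacian (coneGraph (k + 3) q) *ᵥ x) (.inr (.inl i)) =
      (x (.inr (.inl i)) + x (.inl 0)) + (x (.inr (.inl i)) + x (.inr (.inl (i - 1)))) +
        (x (.inr (.inl i)) + x (.inr (.inl (i + 1)))) := by
  classical
  have h : ∑ j, (if (SimpleGraph.cycleGraph (k + 3)).Adj i j then
      x (.inr (.inl i)) + x (.inr (.inl j)) else 0) =
      (x (.inr (.inl i)) + x (.inr (.inl (i - 1)))) +
        (x (.inr (.inl i)) + x (.inr (.inl (i + 1)))) := by
    rw [← sum_filter, ← SimpleGraph.neighborFinset_eq_filter,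
      SimpleGraph.cycleGraph_neighborFinset, sum_pair]
    have := (SimpleGraph.cycleGraph_degree_two_le (v := i)).symm.trans
      SimpleGraph.cycleGraph_degree_three_le
    intro h
    simp [h] at this
  rw [signlessLaplacian_mulVec]
  simp only [coneGraph, join, SimpleGraph.sup_adj, Fintype.sum_sum_type]
  simp only [SimpleGraph.sum_adj, completeBipartiteGraph_adj]
  simp only [univ_unique, Fin.default_eq_zero, Fin.isValue, sum_singleton]
  simp
  rw [h]; ring

lemma cone_mulVec_edge (x : Fin 1 ⊕ (Fin (k + 3) ⊕ Fin q × Fin 2) → ℝ) (a : Fin q) (b : Fin 2) :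
    (signlessLaplacian (coneGraph (k + 3) q) *ᵥ x) (.inr (.inr (a, b))) =
      (x (.inr (.inr (a, b))) + x (.inl 0)) +
        (x (.inr (.inr (a, 0))) + x (.inr (.inr (a, 1)))) := by
  rw [signlessLaplacian_mulVec]
  have h : ∀ c : Fin q, (a = c) = (c = a) := fun c => propext eq_comm
  fin_cases b <;> simp [coneGraph, join, copies, Fintype.sum_prod_type, ite_and, h]; ring

lemma cone_form (x : Fin 1 ⊕ (Fin (k + 3) ⊕ Fin q × Fin 2) → ℝ) :
    x ⬝ᵥ signlessLaplacian (coneGraph (k + 3) q) *ᵥ x =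
      ∑ i, ((x (.inl 0) + x (.inr (.inl i))) ^ 2 +
        (x (.inr (.inl i)) + x (.inr (.inl (i + 1)))) ^ 2) +
      ∑ a, ((x (.inl 0) + x (.inr (.inr (a, 0)))) ^ 2 + (x (.inl 0) + x (.inr (.inr (a, 1)))) ^ 2 +
        (x (.inr (.inr (a, 0))) + x (.inr (.inr (a, 1)))) ^ 2) := by
  simp only [dotProduct, Fintype.sum_sum_type, Fintype.sum_prod_type, Fin.sum_univ_two,
    univ_unique, Fin.default_eq_zero, sum_singleton, cone_mulVec_apex, cone_mulVec_cycle,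
    cone_mulVec_edge]
  have hshift : ∑ i, (x (.inr (.inl i)) * (x (.inr (.inl i)) + x (.inr (.inl (i - 1))))) =
      ∑ i, (x (.inr (.inl (i + 1))) * (x (.inr (.inl (i + 1))) + x (.inr (.inl i)))) := by
    rw [← Equiv.sum_comp (Equiv.addRight (1 : Fin (k + 3)))]
    simp
  have hsplit : ∀ i : Fin (k + 3), x (.inr (.inl i)) *
      ((x (.inr (.inl i)) + x (.inl 0)) + (x (.inr (.inl i)) + x (.inr (.inl (i - 1)))) +
        (x (.inr (.inl i)) + x (.inr (.inl (i + 1))))) =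
      x (.inr (.inl i)) * (x (.inr (.inl i)) + x (.inl 0)) +
      x (.inr (.inl i)) * (x (.inr (.inl i)) + x (.inr (.inl (i + 1)))) +
      x (.inr (.inl i)) * (x (.inr (.inl i)) + x (.inr (.inl (i - 1)))) := fun i => by ring
  simp only [hsplit, sum_add_distrib (f := fun i =>
      x (.inr (.inl i)) * (x (.inr (.inl i)) + x (.inl 0)) +
      x (.inr (.inl i)) * (x (.inr (.inl i)) + x (.inr (.inl (i + 1)))))]
  rw [hshift, mul_add, mul_sum, mul_sum, ← sum_add_distrib, add_add_add_comm, ← sum_add_distrib,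
    ← sum_add_distrib]
  congr 1
  · exact sum_congr rfl fun i _ => by ring
  · exact sum_congr rfl fun i _ => by ring

/-- All signless Laplacian eigenvalues of the cone are at least `1`. -/
lemma cone_lower_bound (x : Fin 1 ⊕ (Fin (k + 3) ⊕ Fin q × Fin 2) → ℝ) :
    1 * (x ⬝ᵥ x) ≤ x ⬝ᵥ signlessLaplacian (coneGraph (k + 3) q) *ᵥ x := by
  rw [cone_form, cone_dotProduct_self]
  set z := x (.inl 0)
  set y := fun i => x (.inr (.inl i)) with hy
  have hc : ∑ i, (y i ^ 2 + (3 / 4) * z ^ 2 + z * (y i - y (i + 1))) ≤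
      ∑ i, ((z + y i) ^ 2 + (y i + y (i + 1)) ^ 2) :=
    sum_le_sum fun i _ => by nlinarith [sq_nonneg (z / 2 + (y i + y (i + 1)))]
  have he : ∑ a : Fin q, (x (.inr (.inr (a, 0))) ^ 2 + x (.inr (.inr (a, 1))) ^ 2) ≤
      ∑ a : Fin q, ((z + x (.inr (.inr (a, 0)))) ^ 2 + (z + x (.inr (.inr (a, 1)))) ^ 2 +
        (x (.inr (.inr (a, 0))) + x (.inr (.inr (a, 1)))) ^ 2) :=
    sum_le_sum fun a _ => by
      nlinarith [sq_nonneg (z + (x (.inr (.inr (a, 0))) + x (.inr (.inr (a, 1))))), sq_nonneg z]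
  rw [sum_add_distrib, sum_add_distrib, ← mul_sum, ← mul_sum, sum_sub_distrib, sum_succ_cycle,
    sub_self,
    mul_zero, sum_const, card_univ, Fintype.card_fin, nsmul_eq_mul] at hc
  push_cast at hc
  nlinarith [sq_nonneg z, mul_nonneg (Nat.cast_nonneg k : (0 : ℝ) ≤ k) (sq_nonneg z)]

/-- The second largest signless Laplacian eigenvalue of the cone is less than `5`. -/
lemma cone_hyperplane_bound :
    ∃ l : Fin 1 ⊕ (Fin (k + 3) ⊕ Fin q × Fin 2) → ℝ, ∀ x ≠ 0, l ⬝ᵥ x = 0 →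
      x ⬝ᵥ signlessLaplacian (coneGraph (k + 3) q) *ᵥ x < 5 * (x ⬝ᵥ x) := by
  -- on this hyperplane the apex value is minus the mean of the others, which makes the cross
  -- term `-2 z S` of the form nonnegative
  refine ⟨Sum.elim (fun _ => k + 3 + 2 * q) 1, fun x hx hl => ?_⟩
  have hl' : ((k : ℝ) + 3 + 2 * q) * x (.inl 0) + (∑ i, x (.inr (.inl i)) +
      ∑ a, (x (.inr (.inr (a, 0))) + x (.inr (.inr (a, 1))))) = 0 := by
    simpa [dotProduct, Fintype.sum_prod_type] using hl
  have hgap : 5 * (x ⬝ᵥ x) - x ⬝ᵥ signlessLaplacian (coneGraph (k + 3) q) *ᵥ x =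
      ((k : ℝ) + 3 + 2 * q + 5) * x (.inl 0) ^ 2 +
      (∑ i, (x (.inr (.inl i)) - x (.inr (.inl (i + 1)))) ^ 2 +
      ∑ a, (2 * (x (.inr (.inr (a, 0))) ^ 2 + x (.inr (.inr (a, 1))) ^ 2) +
        (x (.inr (.inr (a, 0))) - x (.inr (.inr (a, 1)))) ^ 2)) := by
    rw [cone_form, cone_dotProduct_self]
    set z := x (.inl 0)
    set y := fun i => x (.inr (.inl i)) with hy
    have hc : ∑ i, ((z + y i) ^ 2 + (y i + y (i + 1)) ^ 2) =
        (k + 3) * z ^ 2 + 2 * z * ∑ i, y i + 5 * ∑ i, y i ^ 2 - ∑ i, (y i - y (i + 1)) ^ 2 := by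
      have : ∀ i, (z + y i) ^ 2 + (y i + y (i + 1)) ^ 2 =
          z ^ 2 + 2 * z * y i + 3 * y i ^ 2 + 2 * y (i + 1) ^ 2 - (y i - y (i + 1)) ^ 2 :=
        fun i => by ring
      simp_rw [this]
      rw [sum_sub_distrib, sum_add_distrib, sum_add_distrib, sum_add_distrib, ← mul_sum,
        ← mul_sum, ← mul_sum, sum_succ_cycle (fun i => y i ^ 2), sum_const, card_univ,
        Fintype.card_fin, nsmul_eq_mul]
      push_cast; ring
    have he : ∑ a : Fin q, ((z + x (.inr (.inr (a, 0)))) ^ 2 + (z + x (.inr (.inr (a, 1)))) ^ 2 +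
        (x (.inr (.inr (a, 0))) + x (.inr (.inr (a, 1)))) ^ 2) =
        2 * q * z ^ 2 + 2 * z * ∑ a : Fin q, (x (.inr (.inr (a, 0))) + x (.inr (.inr (a, 1)))) +
        5 * ∑ a : Fin q, (x (.inr (.inr (a, 0))) ^ 2 + x (.inr (.inr (a, 1))) ^ 2) -
        ∑ a : Fin q, (2 * (x (.inr (.inr (a, 0))) ^ 2 + x (.inr (.inr (a, 1))) ^ 2) +
          (x (.inr (.inr (a, 0))) - x (.inr (.inr (a, 1)))) ^ 2) := by
      have : (2 * q * z ^ 2 : ℝ) = ∑ a : Fin q, 2 * z ^ 2 := by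
        rw [sum_const, card_univ, Fintype.card_fin, nsmul_eq_mul]; ring
      rw [this, mul_sum, mul_sum, ← sum_add_distrib, ← sum_add_distrib, ← sum_sub_distrib]
      exact sum_congr rfl fun a _ => by ring
    rw [hc, he]
    linear_combination -2 * z * hl'
  have h1 : 0 ≤ ∑ i, (x (.inr (.inl i)) - x (.inr (.inl (i + 1)))) ^ 2 :=
    sum_nonneg fun i _ => sq_nonneg _
  have h2 : ∀ a, 0 ≤ 2 * (x (.inr (.inr (a, 0))) ^ 2 + x (.inr (.inr (a, 1))) ^ 2) +
        (x (.inr (.inr (a, 0))) - x (.inr (.inr (a, 1)))) ^ 2 := fun a => by positivity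
  have h2' := sum_nonneg fun a (_ : a ∈ univ) => h2 a
  by_contra! hcon
  have hz : x (.inl 0) = 0 := by
    have : ((k : ℝ) + 3 + 2 * q + 5) * x (.inl 0) ^ 2 = 0 :=
      le_antisymm (by linarith) (by positivity)
    have h5 : ((k : ℝ) + 3 + 2 * q + 5) ≠ 0 := by positivity
    simpa [h5] using this
  rw [hz] at hgap hl'
  have hs1 : ∑ i, (x (.inr (.inl i)) - x (.inr (.inl (i + 1)))) ^ 2 = 0 := by linarith
  have hs2 : ∑ a, (2 * (x (.inr (.inr (a, 0))) ^ 2 + x (.inr (.inr (a, 1))) ^ 2) +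
        (x (.inr (.inr (a, 0))) - x (.inr (.inr (a, 1)))) ^ 2) = 0 := by linarith
  rw [sum_eq_zero_iff_of_nonneg fun i _ => sq_nonneg _] at hs1
  rw [sum_eq_zero_iff_of_nonneg fun a _ => h2 a] at hs2
  have he : ∀ a, x (.inr (.inr (a, 0))) = 0 ∧ x (.inr (.inr (a, 1))) = 0 := by
    intro a
    have := hs2 a (mem_univ a)
    constructor <;> nlinarith [sq_nonneg (x (.inr (.inr (a, 0)))),
      sq_nonneg (x (.inr (.inr (a, 1)))),
      sq_nonneg (x (.inr (.inr (a, 0))) - x (.inr (.inr (a, 1))))]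
  have hstep : ∀ i : Fin (k + 3), x (.inr (.inl (i + 1))) = x (.inr (.inl i)) := fun i => by
    have := pow_eq_zero_iff (two_ne_zero) |>.1 (hs1 i (mem_univ i))
    linarith
  have hconst : ∀ i : Fin (k + 3), x (.inr (.inl i)) = x (.inr (.inl 0)) := by
    intro i
    induction i using Fin.induction with
    | zero => rfl
    | succ i ih => rw [← Fin.coeSucc_eq_succ, hstep, ih]
  simp only [he, hconst, mul_zero, add_zero, zero_add, sum_const_zero, sum_const, card_univ,
    Fintype.card_fin, nsmul_eq_mul] at hl'
  have h00 : x (.inr (.inl 0)) = 0 := by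
    rcases mul_eq_zero.1 hl' with h | h
    · push_cast at h; linarith [(Nat.cast_nonneg k : (0 : ℝ) ≤ k)]
    · exact h
  apply hx
  ext v
  rcases v with a | i | ⟨a, b⟩
  · rw [Subsingleton.elim a 0, hz]; rfl
  · rw [hconst, h00]; rfl
  · fin_cases b
    · exact (he a).1
    · exact (he a).2

/-- The cone has an eigenvalue `c > 5` satisfying the secular equation of its quotient matrix. -/
lemma cone_exists_large_eigenvalue (k q : ℕ)
    [DecidableEq (Fin 1 ⊕ (Fin (k + 3) ⊕ Fin q × Fin 2))] [DecidableRel (coneGraph (k + 3) q).Adj] :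
    ∃ c : ℝ, 5 < c ∧
      c - (k + 3 + 2 * q) = (k + 3 : ℝ) / (c - 5) + (2 * q : ℝ) / (c - 3) ∧
      ∃ x ≠ 0, signlessLaplacian (coneGraph (k + 3) q) *ᵥ x = c • x := by
  obtain ⟨c, hc5, hc⟩ : ∃ c : ℝ, 5 < c ∧ (c - (k + 3 + 2 * q)) * (c - 5) * (c - 3)
      - (k + 3) * (c - 3) - 2 * q * (c - 5) = 0 := by
    let f : ℝ → ℝ := fun c => (c - (k + 3 + 2 * q)) * (c - 5) * (c - 3)
      - (k + 3) * (c - 3) - 2 * q * (c - 5)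
    have hk : (0 : ℝ) ≤ k := Nat.cast_nonneg k
    have hq : (0 : ℝ) ≤ q := Nat.cast_nonneg q
    set b : ℝ := k + 3 + 2 * q + 8 with hb
    have h5b : (5 : ℝ) ≤ b := by linarith
    have hf : ContinuousOn f (Set.Icc 5 b) := by fun_prop
    have hf5 : f 5 < 0 := by simp only [f]; nlinarith
    have hfb : 0 ≤ f b := by
      simp only [f]
      have : (0 : ℝ) ≤ k * k := mul_nonneg hk hk
      have : (0 : ℝ) ≤ q * q := mul_nonneg hq hq
      have : (0 : ℝ) ≤ k * q := mul_nonneg hk hq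
      rw [hb]; nlinarith
    obtain ⟨c, hc, hfc⟩ := intermediate_value_Icc h5b hf ⟨hf5.le, hfb⟩
    refine ⟨c, lt_of_le_of_ne hc.1 ?_, hfc⟩
    rintro rfl
    exact hf5.ne hfc
  have h5 : c - 5 ≠ 0 := by linarith
  have h3 : c - 3 ≠ 0 := by linarith
  have hsec : c - (k + 3 + 2 * q) = (k + 3 : ℝ) / (c - 5) + (2 * q : ℝ) / (c - 3) := by
    field_simp
    linarith
  refine ⟨c, hc5, hsec, Sum.elim (fun _ => 1) (Sum.elim (fun _ => 1 / (c - 5))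
    fun _ => 1 / (c - 3)), ?_, ?_⟩
  · intro h
    simpa using congrFun h (.inl 0)
  · ext v
    rcases v with a | i | ⟨a, b⟩
    · rw [Subsingleton.elim a 0, cone_mulVec_apex]
      simp only [Sum.elim_inl, Sum.elim_inr, sum_const, card_univ, Fintype.card_fin, nsmul_eq_mul,
        Pi.smul_apply, smul_eq_mul]
      push_cast
      linear_combination -hsec
    · rw [cone_mulVec_cycle]
      simp only [Sum.elim_inl, Sum.elim_inr, Pi.smul_apply, smul_eq_mul]
      field_simp; ring
    · rw [cone_mulVec_edge]
      simp only [Sum.elim_inl, Sum.elim_inr, Pi.smul_apply, smul_eq_mul]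
      field_simp; ring

lemma cone_degree_apex : ((coneGraph (k + 3) q).degree (.inl 0) : ℝ) = k + 3 + 2 * q := by
  have := signlessLaplacian_mulVec_one (coneGraph (k + 3) q) (.inl 0)
  rw [cone_mulVec_apex] at this
  simp at this
  linarith

lemma cone_degree_cycle (i : Fin (k + 3)) :
    ((coneGraph (k + 3) q).degree (.inr (.inl i)) : ℝ) = 3 := by
  have := signlessLaplacian_mulVec_one (coneGraph (k + 3) q) (.inr (.inl i))
  rw [cone_mulVec_cycle] at this
  simp at this
  linarith

lemma cone_degree_edge (a : Fin q × Fin 2) :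
    ((coneGraph (k + 3) q).degree (.inr (.inr a)) : ℝ) = 2 := by
  have := signlessLaplacian_mulVec_one (coneGraph (k + 3) q) (.inr (.inr a))
  rw [cone_mulVec_edge] at this
  simp at this
  linarith

lemma cone_sum_degree (f : ℝ → ℝ) :
    ∑ v, f ((coneGraph (k + 3) q).degree v) =
      f (k + 3 + 2 * q) + (k + 3) * f 3 + 2 * q * f 2 := by
  simp only [Fintype.sum_sum_type, univ_unique, Fin.default_eq_zero, sum_singleton,
    cone_degree_apex, cone_degree_cycle, cone_degree_edge, sum_const, card_univ, Fintype.card_fin,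
    Fintype.card_prod, nsmul_eq_mul]
  push_cast
  ring

end Cone

end QSpectral

/-! ### Degrees of a cospectral mate -/

namespace QSpectral

open Matrix Finset

section Degrees

variable {W : Type*} [Fintype W] [DecidableEq W] (H : SimpleGraph W) [DecidableRel H.Adj]

lemma signlessLaplacian_apply_self (v : W) : signlessLaplacian H v v = H.degree v := by
  simp [signlessLaplacian, SimpleGraph.degMatrix]

lemma signlessLaplacian_apply_ne {v w : W} (h : v ≠ w) :
    signlessLaplacian H v w = if H.Adj v w then 1 else 0 := by
  simp [signlessLaplacian, SimpleGraph.degMatrix, h]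

lemma signlessLaplacian_mulVec_eq (x : W → ℝ) (v : W) :
    (signlessLaplacian H *ᵥ x) v = H.degree v * x v + ∑ w ∈ H.neighborFinset v, x w := by
  rw [signlessLaplacian_mulVec, ← sum_filter, ← SimpleGraph.neighborFinset_eq_filter,
    sum_add_distrib, sum_const, nsmul_eq_mul, SimpleGraph.card_neighborFinset_eq_degree]

variable {H}

/-- A graph whose signless Laplacian eigenvalues are all at least `1` has minimum degree at
least `2`. -/
lemma two_le_degree (hlow : ∀ y : W → ℝ, 1 * (y ⬝ᵥ y) ≤ y ⬝ᵥ signlessLaplacian H *ᵥ y) (v : W) :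
    2 ≤ H.degree v := by
  by_contra! hv
  have h1 := hlow (Pi.single v 1)
  simp only [single_dotProduct, mulVec_single_one, col_apply, signlessLaplacian_apply_self,
    Pi.single_eq_same, one_mul] at h1
  have h1' : H.degree v = 1 := by
    have : 1 ≤ H.degree v := by exact_mod_cast h1
    omega
  obtain ⟨w, hw⟩ := (H.degree_pos_iff_exists_adj v).1 (by omega)
  have hvw : v ≠ w := hw.ne
  have hdw : (1 : ℝ) ≤ H.degree w := by
    exact_mod_cast (H.degree_pos_iff_exists_adj w).2 ⟨v, hw.symm⟩
  -- for `x = t e_v - e_w` with `v` a leaf, `⟨x, Qx⟩ - ⟨x, x⟩ = deg w - 1 - 2 t`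
  have h2 := hlow (Pi.single v (H.degree w : ℝ) - Pi.single w 1)
  simp only [sub_dotProduct, single_dotProduct, mulVec_sub, mulVec_single, Pi.sub_apply,
    Pi.smul_apply, col_apply, signlessLaplacian_apply_self, h1',
    signlessLaplacian_apply_ne H hvw, signlessLaplacian_apply_ne H hvw.symm, hw, hw.symm,
    if_true, Pi.single_eq_same, Pi.single_eq_of_ne hvw, Pi.single_eq_of_ne hvw.symm,
    MulOpposite.smul_eq_mul_unop, MulOpposite.unop_op, Nat.cast_one] at h2
  linarith

variable (hsec : ∃ l : W → ℝ, ∀ x ≠ 0, l ⬝ᵥ x = 0 →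
  x ⬝ᵥ signlessLaplacian H *ᵥ x < 5 * (x ⬝ᵥ x))
include hsec

lemma not_two_degree_ge_six {u v : W} (huv : u ≠ v) (hu : 6 ≤ H.degree u) (hv : 6 ≤ H.degree v) :
    False := by
  have hu' : (6 : ℝ) ≤ H.degree u := by exact_mod_cast hu
  have hv' : (6 : ℝ) ≤ H.degree v := by exact_mod_cast hv
  refine not_two_large_directions (signlessLaplacian_isSymm H) hsec (x := Pi.single u 1)
    (y := Pi.single v 1) (α := 1) (γ := 1) ?_ ?_ rfl ?_ one_pos ?_
  · intro a b hab
    have h1 := congrFun hab u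
    have h2 := congrFun hab v
    simp [huv, huv.symm] at h1 h2
    exact ⟨h1, h2⟩
  · simp [signlessLaplacian_apply_self]; linarith
  · simp [signlessLaplacian_apply_self]; linarith
  · simp [signlessLaplacian_apply_ne H huv, huv]
    split_ifs <;> norm_num

/-- The test vectors are the indicator of `u` and the Perron vector of a star with centre `v` and
four leaves avoiding `u`. -/
lemma degree_le_four (hmin : ∀ v, 2 ≤ H.degree v) {u v : W} (huv : v ≠ u) (hu : 14 ≤ H.degree u) :
    H.degree v ≤ 4 := by
  by_contra! hv
  obtain ⟨T, hT, hT4⟩ : ∃ T ⊆ (H.neighborFinset v).erase u, T.card = 4 := by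
    refine exists_subset_card_eq ?_
    have := pred_card_le_card_erase (s := H.neighborFinset v) (a := u)
    rw [SimpleGraph.card_neighborFinset_eq_degree] at this
    omega
  have hTv : ∀ w ∈ T, H.Adj v w ∧ w ≠ u := fun w hw => by
    have := mem_erase.1 (hT hw)
    exact ⟨(H.mem_neighborFinset v w).1 this.2, this.1⟩
  have hvT : v ∉ T := fun h => H.irrefl (hTv v h).1
  have huT : u ∉ T := fun h => (hTv u h).2 rfl
  set y : W → ℝ := fun w => if w = v then 2 else if w ∈ T then 1 else 0 with hy
  have hyv : y v = 2 := by simp [hy]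
  have hyT : ∀ w ∈ T, y w = 1 := fun w hw => by
    have : w ≠ v := fun h => hvT (h ▸ hw)
    simp [hy, this, hw]
  have hyu : y u = 0 := by simp [hy, huv.symm, huT]
  have hy0 : ∀ w, 0 ≤ y w := fun w => by
    simp only [hy]; split_ifs <;> norm_num
  have hsum : ∀ f : W → ℝ, ∑ w, y w * f w = 2 * f v + ∑ w ∈ T, f w := by
    intro f
    have : ∀ w, y w * f w = (if w = v then 2 * f w else 0) + if w ∈ T then f w else 0 := by
      intro w
      by_cases hw : w = v
      · subst hw; simp [hyv, hvT]
      · simp [hy, hw]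
    simp_rw [this]
    rw [sum_add_distrib, sum_ite_eq' univ v, sum_ite_mem, univ_inter]
    simp
  set z := signlessLaplacian H *ᵥ y with hz
  have hzv : 14 ≤ z v := by
    rw [hz, signlessLaplacian_mulVec_eq, hyv]
    have h1 : ∑ w ∈ T, y w ≤ ∑ w ∈ H.neighborFinset v, y w :=
      sum_le_sum_of_subset_of_nonneg (hT.trans (erase_subset _ _)) fun w _ _ => hy0 w
    rw [sum_congr rfl hyT, sum_const, hT4] at h1
    have h2 : (5 : ℝ) ≤ H.degree v := by exact_mod_cast hv
    norm_num at h1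
    linarith
  have hzT : ∀ w ∈ T, 4 ≤ z w := by
    intro w hw
    rw [hz, signlessLaplacian_mulVec_eq, hyT w hw]
    have h1 : y v ≤ ∑ w' ∈ H.neighborFinset w, y w' :=
      single_le_sum (fun w _ => hy0 w) ((H.mem_neighborFinset w v).2 (hTv w hw).1.symm)
    have h2 : (2 : ℝ) ≤ H.degree w := by exact_mod_cast hmin w
    linarith
  have hzu : 0 ≤ z u ∧ z u ≤ 6 := by
    rw [hz, signlessLaplacian_mulVec_eq, hyu, mul_zero, zero_add]
    refine ⟨sum_nonneg fun w _ => hy0 w, ?_⟩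
    have h1 : ∑ w ∈ H.neighborFinset u, y w ≤ ∑ w, y w :=
      sum_le_sum_of_subset_of_nonneg (subset_univ _) fun w _ _ => hy0 w
    have h2 := hsum 1
    simp [hT4] at h2
    linarith
  have hu' : (14 : ℝ) ≤ H.degree u := by exact_mod_cast hu
  refine not_two_large_directions (signlessLaplacian_isSymm H) hsec (x := Pi.single u 1)
    (y := y) (α := 9) (β := z u) (γ := 4) ?_ ?_ ?_ ?_ (by norm_num) ?_
  · intro a b hab
    have h1 := congrFun hab v
    have h2 := congrFun hab u
    simp [huv, hyv, hyu] at h1 h2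
    exact ⟨h2, h1⟩
  · simp [signlessLaplacian_apply_self]; linarith
  · simp [hyu, hz]
  · have h1 : y ⬝ᵥ z = 2 * z v + ∑ w ∈ T, z w := hsum z
    have h2 : y ⬝ᵥ y = 2 * y v + ∑ w ∈ T, y w := hsum y
    have h3 : ∑ w ∈ T, (4 : ℝ) ≤ ∑ w ∈ T, z w := sum_le_sum hzT
    rw [sum_congr rfl hyT, hyv] at h2
    simp [hT4] at h2 h3
    rw [h1, h2]
    linarith
  · nlinarith [hzu.1, hzu.2]

/-- The degree sequence of a graph sharing the spectral data of the cone: one vertex is adjacent to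
all others, and the others have degree `2` or `3`. -/
lemma exists_dominating_vertex {s q : ℕ} (hN : 15 ≤ s + 2 * q)
    (hcard : Fintype.card W = 1 + (s + 2 * q)) (hmin : ∀ v, 2 ≤ H.degree v)
    (h1 : ∑ v, (H.degree v : ℝ) = 4 * s + 6 * q)
    (h2 : ∑ v, ((H.degree v : ℝ) ^ 2 + H.degree v) =
      (s + 2 * q) ^ 2 + (s + 2 * q) + 12 * s + 12 * q) :
    ∃ u, H.degree u = s + 2 * q ∧ ∀ v, v ≠ u → H.degree v = 2 ∨ H.degree v = 3 := by
  have : Nonempty W := Fintype.card_pos_iff.1 (by omega)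
  obtain ⟨u, -, hu⟩ := exists_max_image univ (fun v => H.degree v) univ_nonempty
  have hu5 : ∀ v, v ≠ u → H.degree v ≤ 5 := fun v hv => by
    by_contra! h
    exact not_two_degree_ge_six hsec hv h (le_trans (Nat.succ_le_of_lt h) (hu v (mem_univ v)))
  have huN : H.degree u ≤ s + 2 * q := by have := H.degree_lt_card_verts u; omega
  obtain ⟨k, hk⟩ : ∃ k, H.degree u + k = s + 2 * q := ⟨_, Nat.add_sub_cancel' huN⟩
  have hkR : (H.degree u : ℝ) = (s + 2 * q) - k := by
    have : (H.degree u : ℝ) + k = s + 2 * q := by exact_mod_cast hk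
    linarith
  have hNR : (15 : ℝ) ≤ s + 2 * q := by exact_mod_cast hN
  have hs0 : (0 : ℝ) ≤ s := Nat.cast_nonneg s
  have hq0 : (0 : ℝ) ≤ q := Nat.cast_nonneg q
  have hk0 : (0 : ℝ) ≤ k := Nat.cast_nonneg k
  have hcardR : ∑ v : W, (1 : ℝ) = 1 + (s + 2 * q) := by
    rw [sum_const, card_univ, hcard]; simp
  -- for `2 ≤ deg v ≤ 5`, `(deg v - 2)(deg v - 3) ≤ 2 (deg v - 2)`; both sides have known sums
  have hlin : ∑ v ∈ univ.erase u, ((H.degree v : ℝ) - 2) = s + k := by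
    have h3 := add_sum_erase univ (fun v => (H.degree v : ℝ) - 2) (mem_univ u)
    have h4 : ∑ v, ((H.degree v : ℝ) - 2) = 4 * s + 6 * q - 2 * (1 + (s + 2 * q)) := by
      rw [sum_sub_distrib, h1, ← hcardR, mul_sum]; simp
    rw [h4] at h3
    linarith
  have hquad : ∑ v ∈ univ.erase u, ((H.degree v : ℝ) - 2) * ((H.degree v : ℝ) - 3) =
      k * (2 * (s + 2 * q) - k - 5) := by
    have h3 := add_sum_erase univ (fun v => ((H.degree v : ℝ) - 2) * ((H.degree v : ℝ) - 3))
      (mem_univ u)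
    have h4 : ∑ v, ((H.degree v : ℝ) - 2) * ((H.degree v : ℝ) - 3) =
        ((s + 2 * q) ^ 2 + (s + 2 * q) + 12 * s + 12 * q) - 6 * (4 * s + 6 * q) +
          6 * (1 + (s + 2 * q)) := by
      rw [← h1, ← h2, ← hcardR, mul_sum, mul_sum, ← sum_sub_distrib, ← sum_add_distrib]
      exact sum_congr rfl fun v _ => by ring
    rw [h4, hkR] at h3
    linear_combination h3
  have hminR : ∀ v, (2 : ℝ) ≤ H.degree v := fun v => by exact_mod_cast hmin v
  have hk1 : k ≤ 1 := by
    by_contra! hk2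
    have hk2R : (2 : ℝ) ≤ k := by exact_mod_cast hk2
    have h3 : ∑ v ∈ univ.erase u, ((H.degree v : ℝ) - 2) * ((H.degree v : ℝ) - 3) ≤
        2 * ∑ v ∈ univ.erase u, ((H.degree v : ℝ) - 2) := by
      rw [mul_sum]
      refine sum_le_sum fun v hv => ?_
      have : (H.degree v : ℝ) ≤ 5 := by exact_mod_cast hu5 v (ne_of_mem_erase hv)
      nlinarith [hminR v]
    rw [hlin, hquad] at h3
    have h4 : (k : ℝ) ≤ (s + 2 * q) - 2 := by linarith [hminR u]
    -- concavity in `k` on `[2, s + 2 q - 2]`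
    nlinarith [mul_nonneg (sub_nonneg.2 hk2R) (sub_nonneg.2 h4)]
  have hdeg4 : ∀ v, v ≠ u → H.degree v ≤ 4 := fun v hv =>
    degree_le_four hsec hmin hv (by omega)
  have hk00 : k = 0 := by
    by_contra hk'
    have hk1' : k = 1 := by omega
    have h3 : ∑ v ∈ univ.erase u, ((H.degree v : ℝ) - 2) * ((H.degree v : ℝ) - 3) ≤
        ∑ v ∈ univ.erase u, ((H.degree v : ℝ) - 2) := by
      refine sum_le_sum fun v hv => ?_
      have : (H.degree v : ℝ) ≤ 4 := by exact_mod_cast hdeg4 v (ne_of_mem_erase hv)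
      nlinarith [hminR v]
    rw [hlin, hquad, hk1'] at h3
    push_cast at h3
    linarith
  refine ⟨u, by omega, fun v hv => ?_⟩
  rw [hk00, Nat.cast_zero, zero_mul] at hquad
  have hnn : ∀ w ∈ univ.erase u, 0 ≤ ((H.degree w : ℝ) - 2) * ((H.degree w : ℝ) - 3) := by
    intro w _
    rcases (hmin w).eq_or_lt with h | h
    · rw [← h]; norm_num
    · have : (3 : ℝ) ≤ H.degree w := by exact_mod_cast h
      nlinarith
  rcases mul_eq_zero.1 ((sum_eq_zero_iff_of_nonneg hnn).1 hquad v
    (mem_erase.2 ⟨hv, mem_univ v⟩)) with h | h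
  · left; exact_mod_cast sub_eq_zero.1 h
  · right; exact_mod_cast sub_eq_zero.1 h

end Degrees

end QSpectral

/-! ### Removing the dominating vertex -/

namespace QSpectral

open Matrix Finset

section Apex

variable {W : Type*} [Fintype W] [DecidableEq W] {H : SimpleGraph W} [DecidableRel H.Adj] {u : W}

/-- The graph obtained from `H` by deleting the vertex `u`. -/
abbrev deleteVertex (H : SimpleGraph W) (u : W) : SimpleGraph {v // v ≠ u} :=
  H.comap Subtype.val

lemma adj_of_degree_eq_card_sub_one (hu : H.degree u + 1 = Fintype.card W) {v : W} (hv : v ≠ u) :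
    H.Adj u v := by
  have h1 : H.neighborFinset u = univ.erase u := by
    refine eq_of_subset_of_card_le (fun w hw => ?_) ?_
    · exact mem_erase.2 ⟨((H.mem_neighborFinset u w).1 hw).ne', mem_univ w⟩
    · rw [card_erase_of_mem (mem_univ u), card_univ, SimpleGraph.card_neighborFinset_eq_degree]
      omega
  rw [← SimpleGraph.mem_neighborFinset, h1]
  exact mem_erase.2 ⟨hv, mem_univ v⟩

variable (hadj : ∀ v, v ≠ u → H.Adj u v)
include hadj

lemma signlessLaplacian_mulVec_apex (x : W → ℝ) :
    (signlessLaplacian H *ᵥ x) u = ∑ v : {v // v ≠ u}, (x u + x v) := by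
  rw [signlessLaplacian_mulVec, Fintype.sum_eq_add_sum_subtype_ne _ u]
  simp only [SimpleGraph.irrefl, if_false, zero_add]
  exact sum_congr rfl fun v _ => if_pos (hadj v v.2)

lemma signlessLaplacian_mulVec_of_ne_apex (x : W → ℝ) (v : {v // v ≠ u}) :
    (signlessLaplacian H *ᵥ x) v =
      (x v + x u) + (signlessLaplacian (deleteVertex H u) *ᵥ fun w => x w) v := by
  rw [signlessLaplacian_mulVec, signlessLaplacian_mulVec, Fintype.sum_eq_add_sum_subtype_ne _ u,
    if_pos (hadj v v.2).symm]
  simp only [SimpleGraph.comap_adj]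

lemma degree_deleteVertex (v : {v // v ≠ u}) :
    (deleteVertex H u).degree v + 1 = H.degree v := by
  have h := signlessLaplacian_mulVec_of_ne_apex hadj 1 v
  rw [signlessLaplacian_mulVec_one] at h
  have h' := signlessLaplacian_mulVec_one (deleteVertex H u) v
  have h1 : (fun w : {v // v ≠ u} => (1 : W → ℝ) w) = 1 := rfl
  rw [h1, h', Pi.one_apply, Pi.one_apply] at h
  have : ((deleteVertex H u).degree v : ℝ) + 1 = H.degree v := by linarith
  exact_mod_cast this

variable (hdeg : ∀ v, (deleteVertex H u).degree v = 1 ∨ (deleteVertex H u).degree v = 2)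
include hdeg

/-- If `H` has the eigenvalue `c > 5` of the cone, then every component of `H - u` is regular: the
all-ones vector satisfies `(B - 2)(B - 4) 1 = 0` for the signless Laplacian `B` of `H - u`. -/
lemma degree_eq_of_adj_deleteVertex {s q : ℕ} (hcard : Fintype.card W = 1 + (s + 2 * q))
    (hsum : ∑ v, (deleteVertex H u).degree v = 2 * s + 2 * q) {c : ℝ} (hc : 5 < c)
    (hsec : c - (s + 2 * q) = (s : ℝ) / (c - 5) + (2 * q : ℝ) / (c - 3))
    (heig : ∃ x ≠ 0, signlessLaplacian H *ᵥ x = c • x) {v w : {v // v ≠ u}}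
    (hvw : (deleteVertex H u).Adj v w) :
    (deleteVertex H u).degree v = (deleteVertex H u).degree w := by
  set K := deleteVertex H u
  have hB4 : ∀ x : {v // v ≠ u} → ℝ, x ⬝ᵥ signlessLaplacian K *ᵥ x ≤ 4 * (x ⬝ᵥ x) := fun x => by
    have := signlessLaplacian_form_le K (k := 2)
      (fun v => (hdeg v).elim (fun h => h.le.trans one_le_two) fun h => h.le) x
    norm_num at this ⊢
    exact this
  obtain ⟨x, hx, hQx⟩ := heig
  set x' : {v // v ≠ u} → ℝ := fun w => x w with hx'
  have hx1 : ∀ v, (c - 1) * x' v - (signlessLaplacian K *ᵥ x') v = x u := fun v => by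
    have h1 := congrFun hQx v
    rw [signlessLaplacian_mulVec_of_ne_apex hadj, Pi.smul_apply, smul_eq_mul] at h1
    simp only [hx']
    linarith
  have hz : x u ≠ 0 := by
    intro hz
    apply hx
    have h1 : signlessLaplacian K *ᵥ x' = (c - 1) • x' := by
      ext v
      have := hx1 v
      rw [Pi.smul_apply, smul_eq_mul]
      linarith
    have h2 := hB4 x'
    rw [h1, dotProduct_smul, smul_eq_mul] at h2
    have h3 : 0 ≤ x' ⬝ᵥ x' := by
      simp only [dotProduct]; exact sum_nonneg fun i _ => mul_self_nonneg _
    have h4 : x' ⬝ᵥ x' = 0 := by nlinarith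
    have h5 := dotProduct_self_eq_zero.1 h4
    ext v
    by_cases hv : v = u
    · rw [hv, hz]; rfl
    · exact congrFun h5 ⟨v, hv⟩
  have hcardK : Fintype.card {v // v ≠ u} = s + 2 * q := by
    rw [Fintype.card_subtype_compl, Fintype.card_subtype_eq]; omega
  have hN : ∑ v : {v // v ≠ u}, (1 : ℝ) = s + 2 * q := by
    rw [sum_const, card_univ, hcardK]; simp
  have hsumR : ∑ v, (K.degree v : ℝ) = 2 * s + 2 * q := by exact_mod_cast hsum
  have hsumsq : ∑ v, (K.degree v : ℝ) ^ 2 = 4 * s + 2 * q := by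
    have : ∀ v, (K.degree v : ℝ) ^ 2 = 3 * K.degree v - 2 * 1 := fun v => by
      rcases hdeg v with h | h <;> rw [h] <;> norm_num
    simp_rw [this]
    rw [sum_sub_distrib, ← mul_sum, ← mul_sum, hN, hsumR]
    ring
  have hB1 : signlessLaplacian K *ᵥ 1 = fun v => 2 * (K.degree v : ℝ) :=
    funext (signlessLaplacian_mulVec_one K)
  have hapex := congrFun hQx u
  rw [signlessLaplacian_mulVec_apex hadj, Pi.smul_apply, smul_eq_mul, sum_add_distrib] at hapex
  have hNx : ∑ v : {v // v ≠ u}, x u = (s + 2 * q) * x u := by rw [← hN, sum_mul]; simp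
  rw [hNx] at hapex
  have key := annihilates_of_resolvent_eq (signlessLaplacian_isSymm K) hB4 (μ := c - 1) (a := s)
    (b := 2 * q) (e := 1) (y := (x u)⁻¹ • x') (by linarith) ?_ ?_ ?_ ?_ ?_
  · -- the identity `(B - 2)(B - 4) 1 = 0`, evaluated with `B 1 = 2 deg`
    have key' : ∀ v, K.degree v * (K.degree v : ℝ) + ∑ w ∈ K.neighborFinset v, (K.degree w : ℝ)
        - 6 * K.degree v + 4 = 0 := fun v => by
      have h1 := congrFun key v
      have h2 : (fun v => 2 * (K.degree v : ℝ)) = (2 : ℝ) • fun v => (K.degree v : ℝ) := rfl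
      rw [hB1, h2, mulVec_smul] at h1
      simp only [Pi.add_apply, Pi.sub_apply, Pi.smul_apply, smul_eq_mul, Pi.zero_apply,
        Pi.one_apply, signlessLaplacian_mulVec_eq] at h1
      linarith
    have hv := key' v
    have hwm : w ∈ K.neighborFinset v := (K.mem_neighborFinset v w).2 hvw
    have hcardv : ∑ w ∈ K.neighborFinset v, (1 : ℝ) = K.degree v := by simp
    -- `deg w` is extremal on the neighbours `w` of `v`, because their average is the extreme value
    rcases hdeg v with h | h
    · have h0 : ∑ w ∈ K.neighborFinset v, ((K.degree w : ℝ) - 1) = 0 := by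
        rw [sum_sub_distrib, hcardv]
        rw [h] at hv ⊢
        norm_num at hv ⊢; linarith
      have h1 := (sum_eq_zero_iff_of_nonneg fun w _ => by
        rcases hdeg w with h | h <;> rw [h] <;> norm_num).1 h0 w hwm
      rw [h]
      exact_mod_cast (sub_eq_zero.1 h1).symm
    · have h0 : ∑ w ∈ K.neighborFinset v, (2 * 1 - (K.degree w : ℝ)) = 0 := by
        rw [sum_sub_distrib, ← mul_sum, hcardv]
        rw [h] at hv ⊢
        norm_num at hv ⊢; linarith
      have h1 := (sum_eq_zero_iff_of_nonneg fun w _ => by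
        rcases hdeg w with h | h <;> rw [h] <;> norm_num).1 h0 w hwm
      rw [h]
      rw [mul_one] at h1
      exact_mod_cast sub_eq_zero.1 h1
  · ext v
    rw [mulVec_smul, Pi.sub_apply, Pi.smul_apply, Pi.smul_apply, Pi.smul_apply, smul_eq_mul,
      smul_eq_mul, smul_eq_mul, Pi.one_apply]
    have := hx1 v
    field_simp
    linarith
  · simp only [dotProduct, Pi.one_apply, mul_one]
    exact hN
  · rw [hB1]
    simp only [dotProduct, Pi.one_apply, one_mul]
    rw [← mul_sum, hsumR]; ring
  · rw [hB1]
    simp only [dotProduct]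
    have : ∀ v, 2 * (K.degree v : ℝ) * (2 * K.degree v) = 4 * (K.degree v : ℝ) ^ 2 :=
      fun v => by ring
    simp_rw [this]
    rw [← mul_sum, hsumsq]; ring
  · rw [dotProduct_smul, show c - 1 - 4 = c - 5 by ring, show c - 1 - 2 = c - 3 by ring, ← hsec,
      smul_eq_mul]
    simp only [dotProduct, Pi.one_apply, one_mul]
    field_simp
    linarith

omit hdeg in
/-- A function on `H - u` of sum zero that is constant along edges and supported on vertices of
degree `2` extends by zero to an eigenvector of eigenvalue `5`. Together with the dominating
vertex it would produce two eigenvalues `≥ 5`. -/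
lemma eq_zero_of_locally_constant
    (hsec : ∃ l : W → ℝ, ∀ x ≠ 0, l ⬝ᵥ x = 0 →
      x ⬝ᵥ signlessLaplacian H *ᵥ x < 5 * (x ⬝ᵥ x)) (hu : 6 ≤ H.degree u)
    {f : {v // v ≠ u} → ℝ} (hf : ∀ v w, (deleteVertex H u).Adj v w → f v = f w)
    (hf2 : ∀ v, f v ≠ 0 → (deleteVertex H u).degree v = 2) (hf0 : ∑ v, f v = 0) : f = 0 := by
  by_contra hne
  obtain ⟨v0, hv0⟩ := Function.ne_iff.1 hne
  set x : W → ℝ := fun v => if h : v ≠ u then f ⟨v, h⟩ else 0 with hx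
  have hxu : x u = 0 := by simp [hx]
  have hxv : ∀ v : {v // v ≠ u}, x v = f v := fun v => by simp [hx, v.2]
  have hxf : (fun v : {v // v ≠ u} => x v) = f := funext hxv
  have hQx : signlessLaplacian H *ᵥ x = (5 : ℝ) • x := by
    ext v
    rw [Pi.smul_apply, smul_eq_mul]
    by_cases hv : v = u
    · subst hv
      rw [signlessLaplacian_mulVec_apex hadj, hxu]
      simp only [hxv, zero_add, mul_zero, hf0]
    · have h1 := signlessLaplacian_mulVec_of_ne_apex hadj x ⟨v, hv⟩
      rw [hxf, signlessLaplacian_mulVec_eq (deleteVertex H u),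
        sum_congr rfl (g := fun _ => f ⟨v, hv⟩)
          fun w hw => (hf _ _ ((SimpleGraph.mem_neighborFinset _ _ _).1 hw)).symm, sum_const,
        SimpleGraph.card_neighborFinset_eq_degree, nsmul_eq_mul, hxu, hxv ⟨v, hv⟩] at h1
      rw [h1, hxv ⟨v, hv⟩]
      by_cases h0 : f ⟨v, hv⟩ = 0
      · simp [h0]
      · rw [hf2 _ h0]; push_cast; ring
  have hu' : (6 : ℝ) ≤ H.degree u := by exact_mod_cast hu
  refine not_two_large_directions (signlessLaplacian_isSymm H) hsec (x := Pi.single u 1)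
    (y := x) (α := 1) (γ := 0) ?_ ?_ rfl ?_ one_pos ?_
  · intro a b hab
    have h1 := congrFun hab u
    have h2 := congrFun hab v0
    simp [hxu, v0.2, hxv] at h1 h2
    exact ⟨h1, h2.resolve_right hv0⟩
  · simp [signlessLaplacian_apply_self]; linarith
  · rw [hQx, dotProduct_smul, smul_eq_mul, sub_self]
  · rw [hQx]
    simp [hxu]

omit hdeg in
/-- The vertices of degree `2` in `H - u` lie in a single component. -/
lemma reachable_of_degree_eq_two
    (hsec : ∃ l : W → ℝ, ∀ x ≠ 0, l ⬝ᵥ x = 0 →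
      x ⬝ᵥ signlessLaplacian H *ᵥ x < 5 * (x ⬝ᵥ x)) (hu : 6 ≤ H.degree u)
    (hreg : ∀ v w, (deleteVertex H u).Adj v w →
      (deleteVertex H u).degree v = (deleteVertex H u).degree w)
    {a b : {v // v ≠ u}} (ha : (deleteVertex H u).degree a = 2)
    (hb : (deleteVertex H u).degree b = 2) : (deleteVertex H u).Reachable a b := by
  classical
  set K := deleteVertex H u
  by_contra hab
  have hdegr : ∀ {v w}, K.Reachable v w → K.degree v = K.degree w := by
    rintro v w ⟨p⟩
    induction p with
    | nil => rfl
    | cons h p ih => exact (hreg _ _ h).trans ih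
  have hiff : ∀ a {v w}, K.Adj v w → (K.Reachable a v ↔ K.Reachable a w) := fun a v w h =>
    ⟨fun h' => h'.trans h.reachable, fun h' => h'.trans h.symm.reachable⟩
  set A : Finset {v // v ≠ u} := univ.filter (K.Reachable a) with hA
  set B : Finset {v // v ≠ u} := univ.filter (K.Reachable b) with hB
  have hBpos : 0 < B.card := card_pos.2 ⟨b, by simp [hB]⟩
  -- the test function is `|B| 1_A - |A| 1_B` for the components `A` of `a` and `B` of `b`
  have h0 := eq_zero_of_locally_constant hadj hsec hu
    (f := fun v => (if K.Reachable a v then (B.card : ℝ) else 0) -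
      if K.Reachable b v then (A.card : ℝ) else 0)
    (fun v w h => by simp only [hiff a h, hiff b h]) (fun v hv => ?_) ?_
  · have := congrFun h0 a
    have hba : ¬ K.Reachable b a := fun h => hab h.symm
    simp [hba] at this
    exact hBpos.ne' (by rw [this, card_empty])
  · by_cases h1 : K.Reachable a v
    · rw [← hdegr h1, ha]
    · by_cases h2 : K.Reachable b v
      · rw [← hdegr h2, hb]
      · simp [h1, h2] at hv
  · rw [sum_sub_distrib, ← sum_filter, ← sum_filter, sum_const, sum_const, ← hA, ← hB,
      nsmul_eq_mul, nsmul_eq_mul, mul_comm, sub_self]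

end Apex

end QSpectral

/-! ### Cycles, perfect matchings and isomorphisms -/

namespace QSpectral

open Matrix Finset

section Structure

/-- A bijective homomorphism between graphs with the same degree sum is an isomorphism. -/
lemma nonempty_iso_of_bijective_hom {V : Type*} {W : Type*} [Fintype V] [Fintype W]
    {G : SimpleGraph V} {H : SimpleGraph W} [DecidableRel G.Adj] [DecidableRel H.Adj]
    (f : G →g H) (hf : Function.Bijective f) (hdeg : ∑ v, G.degree v = ∑ w, H.degree w) :
    Nonempty (H ≃g G) := by
  classical
  have hsub : ∀ v, (G.neighborFinset v).image f ⊆ H.neighborFinset (f v) := by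
    intro v w hw
    obtain ⟨v', hv', rfl⟩ := mem_image.1 hw
    exact (H.mem_neighborFinset _ _).2 (f.map_adj ((G.mem_neighborFinset _ _).1 hv'))
  have hle : ∀ v ∈ univ, G.degree v ≤ H.degree (f v) := fun v _ => by
    have := card_le_card (hsub v)
    rwa [card_image_of_injective _ hf.1, SimpleGraph.card_neighborFinset_eq_degree,
      SimpleGraph.card_neighborFinset_eq_degree] at this
  have hsum : ∑ v, G.degree v = ∑ v, H.degree (f v) :=
    hdeg.trans (Equiv.sum_comp (Equiv.ofBijective f hf) fun w => H.degree w).symm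
  have heq := (sum_eq_sum_iff_of_le hle).1 hsum
  have himg : ∀ v, (G.neighborFinset v).image f = H.neighborFinset (f v) := fun v => by
    refine eq_of_subset_of_card_le (hsub v) ?_
    rw [card_image_of_injective _ hf.1, SimpleGraph.card_neighborFinset_eq_degree,
      SimpleGraph.card_neighborFinset_eq_degree, heq v (mem_univ v)]
  refine ⟨(RelIso.symm ⟨Equiv.ofBijective f hf, fun {v w} => ⟨fun h => ?_, fun h => f.map_adj h⟩⟩)⟩
  have h1 : f w ∈ (G.neighborFinset v).image f := by
    rw [himg]; exact (H.mem_neighborFinset _ _).2 h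
  obtain ⟨w', hw', hww⟩ := mem_image.1 h1
  rw [← hf.1 hww]
  exact (G.mem_neighborFinset _ _).1 hw'

/-- A connected `2`-regular graph is a cycle. -/
lemma exists_bijective_hom_cycleGraph {V : Type*} [Fintype V] [Nonempty V] {G : SimpleGraph V}
    [DecidableRel G.Adj] (hconn : G.Preconnected) (hdeg : ∀ v, G.degree v = 2) {s : ℕ}
    (hcard : Fintype.card V = s) :
    ∃ f : SimpleGraph.cycleGraph s →g G, Function.Bijective f := by
  classical
  subst hcard
  have hncard : ∀ v, (G.neighborSet v).ncard = 2 := fun v => by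
    rw [← hdeg v, Set.ncard_eq_toFinset_card']; rfl
  have hcyc : G.IsCycles := fun v _ => hncard v
  obtain ⟨v⟩ := ‹Nonempty V›
  obtain ⟨p, hp, hverts⟩ := hcyc.exists_cycle_toSubgraph_verts_eq_connectedComponentSupp
    (c := G.connectedComponentMk v) (v := v) rfl
    (Set.nonempty_of_ncard_ne_zero (by rw [hncard]; norm_num))
  have hmem : ∀ w, w ∈ p.support := fun w => by
    rw [← SimpleGraph.Walk.mem_verts_toSubgraph, hverts]
    exact SimpleGraph.ConnectedComponent.eq.2 (hconn w v)
  have hham : p.IsHamiltonianCycle := by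
    rw [SimpleGraph.Walk.isHamiltonianCycle_iff_isCycle_and_support_count_tail_eq_one]
    refine ⟨hp, fun w => List.count_eq_one_of_mem hp.support_nodup ?_⟩
    rcases p.mem_support_iff.1 (hmem w) with h | h
    · subst h
      exact SimpleGraph.Walk.end_mem_tail_support hp.not_nil
    · exact h
  have hlen := hham.length_eq
  have h3 := hp.three_le_length
  obtain ⟨f⟩ := (SimpleGraph.cycleGraph_isContained_iff (by omega)).2 ⟨v, p, hp, hlen⟩
  exact ⟨f.toHom, (Fintype.bijective_iff_injective_and_card _).2 ⟨f.injective, by simp⟩⟩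

/-- A `1`-regular graph is a disjoint union of edges. -/
lemma exists_bijective_hom_copies {V : Type*} [Fintype V] {G : SimpleGraph V} [DecidableRel G.Adj]
    (hdeg : ∀ v, G.degree v = 1) {q : ℕ} (hcard : Fintype.card V = 2 * q) :
    ∃ f : copies q (SimpleGraph.completeGraph (Fin 2)) →g G, Function.Bijective f := by
  classical
  have hex : ∀ v, ∃ w, G.neighborFinset v = {w} := fun v => card_eq_one.1 (hdeg v)
  choose p hp using hex
  have hadj : ∀ v w, G.Adj v w ↔ w = p v := fun v w => by
    rw [← G.mem_neighborFinset, hp, mem_singleton]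
  have hpp : ∀ v, p (p v) = v := fun v =>
    ((hadj _ _).1 ((hadj v (p v)).2 rfl).symm).symm
  have hpne : ∀ v, p v ≠ v := fun v h => G.irrefl ((hadj v v).2 h.symm)
  -- a linear order singles out one endpoint of every edge
  let : LinearOrder V := LinearOrder.lift' (Fintype.equivFin V) (Fintype.equivFin V).injective
  have hT : (univ.filter fun v => v < p v).card = q := by
    have h1 : (univ.filter fun v => ¬ v < p v) = (univ.filter fun v => v < p v).image p := by
      ext v
      simp only [mem_filter, mem_univ, true_and, mem_image]
      constructor
      · intro h
        refine ⟨p v, ?_, hpp v⟩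
        rw [hpp]
        exact lt_of_le_of_ne (not_lt.1 h) (hpne v)
      · rintro ⟨w, hw, rfl⟩
        rw [hpp]
        exact not_lt.2 hw.le
    have h2 := card_filter_add_card_filter_not (s := (univ : Finset V)) (fun v => v < p v)
    rw [h1, card_image_of_injective _ (Function.LeftInverse.injective hpp), card_univ, hcard] at h2
    omega
  have e : Fin q ≃ {v // v < p v} := (Fintype.equivFinOfCardEq (by
    rw [Fintype.card_subtype, hT])).symm
  let g : Fin q × Fin 2 → V := fun a => if a.2 = 0 then e a.1 else p (e a.1)
  have hg0 : ∀ a, g (a, 0) = e a := fun a => rfl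
  have hg1 : ∀ a, g (a, 1) = p (e a) := fun a => rfl
  refine ⟨⟨g, ?_⟩, (Fintype.bijective_iff_injective_and_card _).2 ⟨?_, ?_⟩⟩
  · rintro ⟨a, b⟩ ⟨a', b'⟩ ⟨h1, h2⟩
    obtain rfl : a = a' := h1
    rw [hadj]
    fin_cases b <;> fin_cases b' <;> simp_all
  · change Function.Injective g
    rintro ⟨a, b⟩ ⟨a', b'⟩ h
    have key : ∀ c c' : Fin q, (e c : V) ≠ p (e c') := fun c c' h => by
      have h1 := (e c).2
      rw [h, hpp] at h1
      exact lt_asymm h1 (e c').2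
    fin_cases b <;> fin_cases b'
    · exact Prod.ext (e.injective (Subtype.ext h)) rfl
    · exact absurd h (key _ _)
    · exact absurd h.symm (key _ _)
    · exact Prod.ext (e.injective (Subtype.ext (Function.LeftInverse.injective hpp h))) rfl
  · rw [hcard, Fintype.card_prod, Fintype.card_fin, Fintype.card_fin, mul_comm]

lemma degree_comap_val {V : Type*} [Fintype V] {K : SimpleGraph V} [DecidableRel K.Adj]
    {P : V → Prop} [DecidablePred P] (hP : ∀ v w, K.Adj v w → P v → P w) (v : {v // P v}) :
    (K.comap (Subtype.val : {v // P v} → V)).degree v = K.degree v := by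
  classical
  rw [← SimpleGraph.card_neighborFinset_eq_degree, ← SimpleGraph.card_neighborFinset_eq_degree,
    ← card_image_of_injective _ Subtype.val_injective]
  congr 1
  ext w
  simp only [mem_image, SimpleGraph.mem_neighborFinset, SimpleGraph.comap_adj, Subtype.exists,
    exists_and_right, exists_eq_right]
  exact ⟨fun ⟨_, h⟩ => h, fun h => ⟨hP v w h v.2, h⟩⟩

lemma reachable_comap_val {V : Type*} {K : SimpleGraph V} {P : V → Prop}
    (hP : ∀ v w, K.Adj v w → P v → P w) {a b : V} (hab : K.Reachable a b) (ha : P a) (hb : P b) :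
    (K.comap (Subtype.val : {v // P v} → V)).Reachable ⟨a, ha⟩ ⟨b, hb⟩ := by
  obtain ⟨p⟩ := hab
  induction p with
  | nil => rfl
  | @cons a c b h p ih =>
    have hc := hP _ _ h ha
    have h1 : (K.comap (Subtype.val : {v // P v} → V)).Adj ⟨a, ha⟩ ⟨c, hc⟩ := h
    exact h1.reachable.trans (ih hc hb)

end Structure

end QSpectral

/-! ### Determination by the spectrum -/

namespace QSpectral

open Matrix Finset

/-- `qSpectrum` is independent of the choice of decidability instances. -/
lemma charpoly_roots_eq_of_qSpectrum_eq {V : Type*} {W : Type*} [Fintype V] [Fintype W]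
    [DecidableEq V] [DecidableEq W] {G : SimpleGraph V} {H : SimpleGraph W} [DecidableRel G.Adj]
    [DecidableRel H.Adj] (h : qSpectrum H = qSpectrum G) :
    (signlessLaplacian G).charpoly.roots = (signlessLaplacian H).charpoly.roots := by
  unfold qSpectrum at h
  convert h.symm

/-- A graph with a dominating vertex `u`, whose other vertices induce a `2`-regular connected graph
on `s` vertices and a perfect matching on `2 q` vertices, is the cone `K_1 ∨ (C_s ∪ q K_2)`. -/
lemma nonempty_iso_coneGraph {W : Type*} [Fintype W] [DecidableEq W] {H : SimpleGraph W}
    [DecidableRel H.Adj] {s q : ℕ} [DecidableRel (coneGraph s q).Adj] (hs : 0 < s) {u : W}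
    (hadj : ∀ v, v ≠ u → H.Adj u v) (hcard : Fintype.card W = 1 + (s + 2 * q))
    (hdeg : ∀ v, (deleteVertex H u).degree v = 1 ∨ (deleteVertex H u).degree v = 2)
    (hsum : ∑ v, (deleteVertex H u).degree v = 2 * s + 2 * q)
    (hreg : ∀ v w, (deleteVertex H u).Adj v w →
      (deleteVertex H u).degree v = (deleteVertex H u).degree w)
    (hreach : ∀ v w, (deleteVertex H u).degree v = 2 → (deleteVertex H u).degree w = 2 →
      (deleteVertex H u).Reachable v w)
    (hsumH : ∑ v, (coneGraph s q).degree v = ∑ w, H.degree w) :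
    Nonempty (H ≃g coneGraph s q) := by
  set K := deleteVertex H u
  have hcardK : Fintype.card {v // v ≠ u} = s + 2 * q := by
    rw [Fintype.card_subtype_compl, Fintype.card_subtype_eq]; omega
  have hP : ∀ k v w, K.Adj v w → K.degree v = k → K.degree w = k :=
    fun k v w h h' => (hreg v w h).symm.trans h'
  have hcard2 : Fintype.card {v // K.degree v = 2} = s := by
    have : ∀ v, K.degree v = 1 + if K.degree v = 2 then 1 else 0 := fun v => by
      rcases hdeg v with h | h <;> rw [h] <;> rfl
    rw [sum_congr rfl fun v _ => this v, sum_add_distrib, sum_const, card_univ, hcardK,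
      ← card_filter] at hsum
    rw [Fintype.card_subtype]
    simp only [smul_eq_mul] at hsum
    omega
  have hcard1 : Fintype.card {v // K.degree v = 1} = 2 * q := by
    have h1 := Fintype.card_subtype_compl fun v => K.degree v = 2
    rw [hcardK, hcard2] at h1
    have h2 : Fintype.card {v // K.degree v = 1} = Fintype.card {v // ¬ K.degree v = 2} :=
      Fintype.card_congr (Equiv.subtypeEquivRight fun v => by
        have : K.degree v = 1 ∨ K.degree v = 2 := hdeg v
        omega)
    omega
  have : Nonempty {v // K.degree v = 2} := Fintype.card_pos_iff.1 (by omega)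
  obtain ⟨f, hf⟩ := exists_bijective_hom_cycleGraph
    (G := K.comap (Subtype.val : {v // K.degree v = 2} → _))
    (fun a b => reachable_comap_val (hP 2) (hreach _ _ a.2 b.2) a.2 b.2)
    (fun v => (degree_comap_val (hP 2) v).trans v.2) hcard2
  obtain ⟨g, hg⟩ := exists_bijective_hom_copies
    (G := K.comap (Subtype.val : {v // K.degree v = 1} → _))
    (fun v => (degree_comap_val (hP 1) v).trans v.2) hcard1
  let F : Fin 1 ⊕ (Fin s ⊕ Fin q × Fin 2) → W :=
    Sum.elim (fun _ => u) (Sum.elim (fun i => (f i).1.1) fun a => (g a).1.1)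
  have hFadj : ∀ {x y}, (coneGraph s q).Adj x y → H.Adj (F x) (F y) := by
    rintro (a | i | a) (b | j | b) hxy <;>
      simp only [coneGraph, join, SimpleGraph.sup_adj, SimpleGraph.sum_adj,
        completeBipartiteGraph_adj] at hxy
    · exact absurd (Subsingleton.elim a b) (by simpa using hxy)
    · exact hadj _ (f j).1.2
    · exact hadj _ (g b).1.2
    · exact (hadj _ (f i).1.2).symm
    · exact f.map_adj (by simpa using hxy)
    · simp at hxy
    · exact (hadj _ (g a).1.2).symm
    · simp at hxy
    · exact g.map_adj (by simpa using hxy)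
  have hfg : ∀ i a, (f i).1.1 ≠ (g a).1.1 := fun i a h => by
    have h1 := (f i).2
    rw [Subtype.ext h, (g a).2] at h1
    exact absurd h1 (by norm_num)
  have hFinj : Function.Injective F := by
    rintro (a | i | a) (b | j | b) h
    · rw [Subsingleton.elim a b]
    · exact absurd h.symm (f j).1.2
    · exact absurd h.symm (g b).1.2
    · exact absurd h (f i).1.2
    · rw [hf.1 (Subtype.ext (Subtype.ext h))]
    · exact absurd h (hfg i b)
    · exact absurd h (g a).1.2
    · exact absurd h.symm (hfg j a)
    · rw [hg.1 (Subtype.ext (Subtype.ext h))]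
  refine nonempty_iso_of_bijective_hom ⟨F, hFadj⟩
    ((Fintype.bijective_iff_injective_and_card _).2 ⟨hFinj, ?_⟩) hsumH
  rw [hcard]
  simp [mul_comm]

end QSpectral

theorem theorem1p1 (s q : ℕ) (hs : 3 ≤ s)
    (hn : 16 ≤ Fintype.card (Fin 1 ⊕ (Fin s ⊕ Fin q × Fin 2))) :
    QSpectral.IsDQS.{0, v} (QSpectral.coneGraph s q) := by
  open QSpectral Finset in
  classical
  obtain ⟨k, rfl⟩ : ∃ k, s = k + 3 := ⟨s - 3, by omega⟩
  intro W _ H hHG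
  have hG := signlessLaplacian_isSymm (coneGraph (k + 3) q)
  have hH := signlessLaplacian_isSymm H
  have hroots := charpoly_roots_eq_of_qSpectrum_eq hHG
  have hcard : Fintype.card W = 1 + ((k + 3) + 2 * q) := by
    rw [← card_eq_of_roots_eq hG hH hroots]
    simp [mul_comm]
  have hN : 15 ≤ (k + 3) + 2 * q := by
    simp at hn
    omega
  have hmin := two_le_degree (lower_bound_of_roots_eq hG hH hroots cone_lower_bound)
  have hsec := hyperplane_bound_of_roots_eq hG hH hroots cone_hyperplane_bound
  have hsumR : ∑ v, (H.degree v : ℝ) = 4 * (k + 3 : ℕ) + 6 * q := by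
    rw [← signlessLaplacian_trace, ← trace_eq_of_roots_eq hG hH hroots, signlessLaplacian_trace,
      cone_sum_degree fun t => t]
    push_cast; ring
  obtain ⟨u, hu, hdegH⟩ := exists_dominating_vertex hsec hN hcard hmin hsumR (by
    rw [← signlessLaplacian_trace_sq, ← trace_sq_eq_of_roots_eq hG hH hroots,
      signlessLaplacian_trace_sq, cone_sum_degree fun t => t ^ 2 + t]
    push_cast; ring)
  have hadj : ∀ v, v ≠ u → H.Adj u v := fun v => adj_of_degree_eq_card_sub_one (by omega)
  have hdeg : ∀ v, (deleteVertex H u).degree v = 1 ∨ (deleteVertex H u).degree v = 2 := fun v => by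
    have := degree_deleteVertex hadj v
    have := hdegH v v.2
    omega
  have hsumH : ∑ v, H.degree v = 4 * (k + 3) + 6 * q := by exact_mod_cast hsumR
  have hsumK : ∑ v, (deleteVertex H u).degree v = 2 * (k + 3) + 2 * q := by
    have h1 := hsumH
    rw [Fintype.sum_eq_add_sum_subtype_ne _ u, hu,
      sum_congr rfl fun v _ => (degree_deleteVertex hadj v).symm, sum_add_distrib, sum_const,
      card_univ, Fintype.card_subtype_compl, Fintype.card_subtype_eq, smul_eq_mul, mul_one] at h1
    omega
  obtain ⟨c, hc, hcsec, heig⟩ := cone_exists_large_eigenvalue k q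
  have hreg : ∀ v w, (deleteVertex H u).Adj v w →
      (deleteVertex H u).degree v = (deleteVertex H u).degree w := fun v w =>
    degree_eq_of_adj_deleteVertex hadj hdeg hcard hsumK hc (by push_cast; exact hcsec)
      (exists_mulVec_eq_smul_of_roots_eq hG hH hroots heig)
  refine nonempty_iso_coneGraph (by omega) hadj hcard hdeg hsumK hreg
    (fun v w => reachable_of_degree_eq_two hadj hsec (by omega) hreg) ?_
  have : ∑ v, ((coneGraph (k + 3) q).degree v : ℝ) = ∑ w, (H.degree w : ℝ) := by
    rw [cone_sum_degree fun t => t, hsumR]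
    push_cast; ring
  exact_mod_cast this
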